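/- Let $f\in\mathbb C[x,y,z]$ be homogeneous of degree $4$ and let $C\colon f=0$ be a smooth projective plane quartic curve over $\mathbb C$ (for instance the base change of a smooth plane quartic over $\mathbb Q$), with Jacobian $J$, where $J(\mathbb C)$ is the group of divisors of degree $0$ on $C$ modulo principal divisors. Fix $P_1,P_2,P_3\in C(\mathbb C)$. A triple of points $T_1,T_2,T_3\in C(\mathbb C)$ is said to represent the class of $\sum_i T_i-\sum_i P_i$ in $J(\mathbb C)$. Given triples $Q_1,Q_2,Q_3$ and $R_1,R_2,R_3$ of points of $C(\mathbb C)$, consider the following algorithm (all intersections are counted with multiplicity, and points may coincide). 1. Pick any point $B\in C(\mathbb C)$. 2. Find a line $\ell$ and an effective divisor $A$ of degree $2$ such that $C$ intersects $\ell$ in $P_1+P_2+A$. 3. Find a cubic $c$ and an effective divisor $E$ of degree $3$ such that $C$ intersects $c$ in $\sum_i Q_i+\sum_i R_i+A+B+E$. 4. Find a conic $n$ and an effective divisor $S$ of degree $3$ such that $C$ intersects $n$ in $B+P_3+E+S$. 5. Output the points $S_1,S_2,S_3$ with $S=S_1+S_2+S_3$. Then the algorithm is correct: each step can be carried out, whatever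 choices were made in the steps before it, and for every run of the algorithm the rational function $\frac{c}{\ell n}$ on $C$ has principal divisor $$\left(\frac{c}{\ell n}\right)=\sum_i Q_i+\sum_i R_i-\sum_i P_i-\sum_i S_i ,$$ the divisor $\sum_i S_i-\sum_i P_i$ is linearly equivalent to $\left(\sum_i Q_i-\sum_i P_i\right)+\left(\sum_i R_i-\sum_i P_i\right)$, and hence, if $Q_1,Q_2,Q_3$ and $R_1,R_2,R_3$ represent $x,y\in J(\mathbb C)$, then $S_1,S_2,S_3$ represent $x+y$. -/

import Mathlib

open scoped LinearAlgebra.Projectivization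

noncomputable section

namespace PlaneQuartic

attribute [local instance] MvPolynomial.gradedAlgebra

/-- Ternary forms of degree `d` over `ℂ`. -/
abbrev Form (d : ℕ) : Submodule ℂ (MvPolynomial (Fin 3) ℂ) :=
  MvPolynomial.homogeneousSubmodule (Fin 3) ℂ d

/-- The complex projective plane. -/
abbrev Plane : Type := ℙ ℂ (Fin 3 → ℂ)

/-- The plane quartic `f = 0` is smooth: at no point of it do all partial derivatives vanish. -/
def IsSmooth (f : Form 4) : Prop :=
  ∀ v : Fin 3 → ℂ, v ≠ 0 → MvPolynomial.eval v f.1 = 0 →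
    ∃ i, MvPolynomial.eval v (MvPolynomial.pderiv i f.1) ≠ 0

/-- The set `C(ℂ)` of complex points of the plane curve `C : f = 0`. -/
def Point (f : Form 4) : Type :=
  {P : Plane // MvPolynomial.eval P.rep f.1 = 0}

/-! ### Local rings and intersection multiplicities -/

/-- The homogeneous prime ideal of a point `P` of the plane: the polynomials that vanish
identically on the line in `ℂ³` corresponding to `P`. -/
def pointIdeal (P : Plane) : Ideal (MvPolynomial (Fin 3) ℂ) :=
  RingHom.ker (MvPolynomial.aeval
    (fun i => Polynomial.C (P.rep i) * Polynomial.X) :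
      MvPolynomial (Fin 3) ℂ →ₐ[ℂ] Polynomial ℂ)

instance pointIdeal_isPrime (P : Plane) : (pointIdeal P).IsPrime :=
  RingHom.ker_isPrime _

/-- The local ring of the projective plane at `P`: fractions `g / h` of forms of the same degree
with `h` not vanishing at `P`. -/
abbrev PlaneLocalRing (P : Plane) : Type :=
  HomogeneousLocalization.AtPrime (MvPolynomial.homogeneousSubmodule (Fin 3) ℂ) (pointIdeal P)

/-- The index of a coordinate that does not vanish at `P`. -/
def chart (P : Plane) : Fin 3 :=
  Classical.choose (Function.ne_iff.mp P.rep_nonzero)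

theorem chart_spec (P : Plane) : P.rep (chart P) ≠ 0 :=
  Classical.choose_spec (Function.ne_iff.mp P.rep_nonzero)

theorem X_chart_pow_mem (P : Plane) (d : ℕ) :
    (MvPolynomial.X (chart P) ^ d : MvPolynomial (Fin 3) ℂ) ∈ (pointIdeal P).primeCompl := by
  intro h
  have h1 := (pointIdeal_isPrime P).mem_of_pow_mem d h
  simp only [pointIdeal, RingHom.mem_ker, MvPolynomial.aeval_X, mul_eq_zero,
    Polynomial.C_eq_zero, Polynomial.X_ne_zero, or_false] at h1
  exact chart_spec P h1

theorem X_chart_pow_form (P : Plane) (d : ℕ) :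
    (MvPolynomial.X (chart P) ^ d : MvPolynomial (Fin 3) ℂ) ∈ Form d := by
  simpa using (MvPolynomial.isHomogeneous_X ℂ (chart P)).pow d

/-- The local equation `g / x_i ^ d` at `P` of a form `g` of degree `d`, where `x_i` is a
coordinate that does not vanish at `P`. -/
def germ {d : ℕ} (g : Form d) (P : Plane) : PlaneLocalRing P :=
  HomogeneousLocalization.mk
    { deg := d
      num := g
      den := ⟨MvPolynomial.X (chart P) ^ d, X_chart_pow_form P d⟩
      den_mem := X_chart_pow_mem P d }

/-- The local ring `𝒪_{C,P}` of the curve `C : f = 0` at its point `P`. -/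
abbrev CurveLocalRing (f : Form 4) (P : Point f) : Type :=
  PlaneLocalRing P.1 ⧸ Ideal.span {germ f P.1}

/-- The intersection multiplicity at `P` of `C : f = 0` with the curve `g = 0`, that is, the order
of vanishing at `P` of the form `g` on `C`: the length of `𝒪_{C,P} / (g)`. -/
def mult (f : Form 4) {d : ℕ} (g : Form d) (P : Point f) : ℕ∞ :=
  Ring.ord (CurveLocalRing f P) (Ideal.Quotient.mk _ (germ g P.1))

/-! ### Divisors -/

/-- Divisors on `C`. -/
abbrev Divisor (f : Form 4) : Type := Point f →₀ ℤ

/-- A point of `C`, as a divisor. -/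
abbrev pt {f : Form 4} (P : Point f) : Divisor f := Finsupp.single P 1

/-- The divisor `T₁ + T₂ + T₃` of a triple of points. -/
def tripleSum {f : Form 4} (T : Fin 3 → Point f) : Divisor f := ∑ i, pt (T i)

/-- The degree of a divisor. -/
abbrev degree {f : Form 4} : Divisor f →+ ℤ := Finsupp.degree

/-- `C` intersects the curve `g = 0` in the divisor `D`: the curves have no common component and
the multiplicity of each point in `D` is the intersection multiplicity there. -/
def IntersectsIn {f : Form 4} {d : ℕ} (g : Form d) (D : Divisor f) : Prop :=
  ∀ P : Point f, ∃ m : ℕ, mult f g P = m ∧ D P = m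

/-! ### Rational functions and linear equivalence -/

/-- The homogeneous coordinate ring of `C`. -/
abbrev CoordRing (f : Form 4) : Type :=
  MvPolynomial (Fin 3) ℂ ⧸ Ideal.span {f.1}

/-- The ring of fractions of the homogeneous coordinate ring. The function field of `C` consists
of the elements of it that are quotients of two forms of the same degree. -/
abbrev Fractions (f : Form 4) : Type := FractionRing (CoordRing f)

/-- A polynomial as an element of the ring of fractions. -/
def toFractions (f : Form 4) (g : MvPolynomial (Fin 3) ℂ) : Fractions f :=
  algebraMap (CoordRing f) (Fractions f) (Ideal.Quotient.mk _ g)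

/-- `φ = g / h` on `C`, where `h` does not vanish identically on `C`. -/
def IsQuotient {f : Form 4} (φ : Fractions f) (g h : MvPolynomial (Fin 3) ℂ) : Prop :=
  h ∉ Ideal.span {f.1} ∧ φ * toFractions f h = toFractions f g

/-- `φ` is a nonzero rational function on `C` whose principal divisor is `D`: at each point `P` the
multiplicity of `D` is `ord_P g - ord_P h`, where `φ = g / h` with forms `g`, `h` of the same
degree that do not vanish identically on `C`. -/
def HasDivisor {f : Form 4} (φ : Fractions f) (D : Divisor f) : Prop :=
  ∀ P : Point f, ∃ (d : ℕ) (g h : Form d) (a b : ℕ),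
    IsQuotient φ g.1 h.1 ∧ mult f g P = a ∧ mult f h P = b ∧ D P = (a : ℤ) - b

/-- Linear equivalence of divisors. -/
def LinearlyEquivalent {f : Form 4} (D D' : Divisor f) : Prop :=
  ∃ φ : Fractions f, HasDivisor φ (D - D')

/-- The group of divisors of degree zero. -/
def degreeZero (f : Form 4) : AddSubgroup (Divisor f) := (degree (f := f)).ker

/-- The group of principal divisors (which form a subgroup if `C` is smooth, so that the closure
adds nothing). -/
def principalDivisors (f : Form 4) : AddSubgroup (Divisor f) :=
  AddSubgroup.closure {D | ∃ φ : Fractions f, HasDivisor φ D}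

/-- The group `J(ℂ)` of complex points of the Jacobian of `C`: divisors of degree zero modulo
principal divisors. -/
abbrev Jacobian (f : Form 4) : Type :=
  degreeZero f ⧸ (principalDivisors f).addSubgroupOf (degreeZero f)

theorem tripleSum_sub_mem {f : Form 4} (P T : Fin 3 → Point f) :
    tripleSum T - tripleSum P ∈ degreeZero f := by
  simp [degreeZero, tripleSum, AddMonoidHom.mem_ker]

/-- The triple `T` represents the point `T₁ + T₂ + T₃ - P₁ - P₂ - P₃` of the Jacobian. -/
def Represents {f : Form 4} (P T : Fin 3 → Point f) (x : Jacobian f) : Prop :=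
  QuotientAddGroup.mk (⟨tripleSum T - tripleSum P, tripleSum_sub_mem P T⟩ : degreeZero f) = x

/-! ### The steps of the addition algorithm

The auxiliary point `B` of the first step is arbitrary. "Through" is understood with
multiplicities, and any line, cubic and conic with the required property may be chosen.
The indices `1, 2, 3` of the triples are `0, 1, 2` here. -/

/-- Second step: `ℓ` is a line through `P₁` and `P₂`, and the effective divisor `A` of degree 2 is
the residual intersection. -/
def StepLine {f : Form 4} (P : Fin 3 → Point f) (l : Form 1) (A : Divisor f) : Prop :=
  l ≠ 0 ∧ 0 ≤ A ∧ degree A = 2 ∧ IntersectsIn l (pt (P 0) + pt (P 1) + A)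

/-- Third step: `c` is a cubic through `Q₁, Q₂, Q₃, R₁, R₂, R₃, A, B`, and the effective divisor
`E` of degree 3 is the residual intersection. -/
def StepCubic {f : Form 4} (Q R : Fin 3 → Point f) (A : Divisor f) (B : Point f)
    (c : Form 3) (E : Divisor f) : Prop :=
  c ≠ 0 ∧ 0 ≤ E ∧ degree E = 3 ∧ IntersectsIn c (tripleSum Q + tripleSum R + A + pt B + E)

/-- Fourth step: `n` is a conic through `B, P₃, E`, and the effective divisor `S` of degree 3 is
the residual intersection. -/
def StepConic {f : Form 4} (P : Fin 3 → Point f) (B : Point f) (E : Divisor f)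
    (n : Form 2) (S : Divisor f) : Prop :=
  n ≠ 0 ∧ 0 ≤ S ∧ degree S = 3 ∧ IntersectsIn n (pt B + pt (P 2) + E + S)

/-- Fifth step: the output `T` is the triple of points of which `S` consists. -/
def StepOutput {f : Form 4} (S : Divisor f) (T : Fin 3 → Point f) : Prop :=
  tripleSum T = S

end PlaneQuartic

end

noncomputable section

namespace PlaneQuartic

open MvPolynomial

attribute [local instance] MvPolynomial.gradedAlgebra

/-! ### Forms -/

/-! Correctness of the output is bookkeeping: subtracting the divisors of `l` and `n` from that of
`c` cancels `A`, `B` and `E`. The substance is that every step is possible. The steps ask for forms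
of degrees 1, 3, 2 through 2, 9, 5 points, while the spaces of forms have dimensions 3, 10, 6. A
point imposes at most one condition (`exists_smul_add_vanishing`), so a nonzero form exists. Its
degree is below 4, so it does not vanish on C, and Bézout (`exists_divisor`) gives a residual
divisor of degree 3 or, for the line, 2.

Bézout rests on two consequences of smoothness: `f` is prime (`IsSmooth.prime`), and the maximal
ideal of each local ring of C is generated by the germ of a line (`exists_local_parameter`). Hence
`mult` is a discrete valuation (`le_ord_iff_pow_dvd`).

The upper bound `4 * d` compares two dimension counts: forms `g a + f b` have codimension at most `4
* d` in their degree, whereas vanishing on a multiset `s` is `s.card` independent conditions in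
large degree (`card_le_of_le_mult`). For the lower bound, a line meets C in at least 4 points
(`four_le_card_of_line`). For general `g`, some product of lines is congruent to `g a` modulo `f`;
its divisor has degree at least 4 times the number of lines, and the upper bound for `a` leaves at
least `4 * d` for `g`. -/

theorem homogeneousComponent_mul_form {a b : ℕ} {g : MvPolynomial (Fin 3) ℂ} (hg : g ∈ Form a)
    (h : MvPolynomial (Fin 3) ℂ) :
    homogeneousComponent (a + b) (g * h) = g * homogeneousComponent b h := by
  have := DirectSum.coe_decompose_mul_add_of_left_mem (homogeneousSubmodule (Fin 3) ℂ)
    (i := a) (j := b) (b := h) hg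
  exact (decomposition.decompose'_apply (g * h) (a + b)).symm.trans
    (this.trans (congrArg (g * ·) (decomposition.decompose'_apply h b)))

theorem mul_mem_form {a b : ℕ} {g h : MvPolynomial (Fin 3) ℂ} (hg : g ∈ Form a)
    (hh : h ∈ Form b) : g * h ∈ Form (a + b) :=
  IsHomogeneous.mul hg hh

/-- The product of two forms. -/
def Form.mul {a b : ℕ} (g : Form a) (h : Form b) : Form (a + b) :=
  ⟨g.1 * h.1, mul_mem_form g.2 h.2⟩

/-- A constant, as a form of degree zero. -/
def Form.const (c : ℂ) : Form 0 := ⟨C c, isHomogeneous_C _ c⟩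

theorem exists_form_of_dvd {a b : ℕ} (g : Form a) {h : MvPolynomial (Fin 3) ℂ}
    (hh : h ∈ Form (a + b)) (hd : g.1 ∣ h) : ∃ k : Form b, h = g.1 * k.1 := by
  obtain ⟨k, rfl⟩ := hd
  refine ⟨⟨homogeneousComponent b k, homogeneousComponent_mem b k⟩, ?_⟩
  rw [← homogeneousComponent_mul_form g.2, homogeneousComponent_eq_self hh]

theorem aeval_mul_const {A : Type*} [CommRing A] [Algebra ℂ A] {d : ℕ}
    {g : MvPolynomial (Fin 3) ℂ} (hg : g ∈ Form d) (v : Fin 3 → A) (t : A) :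
    aeval (fun i => v i * t) g = aeval v g * t ^ d := by
  rw [aeval_def, aeval_def, eval₂_eq, eval₂_eq, Finset.sum_mul]
  refine Finset.sum_congr rfl fun m hm => ?_
  have hm' : m.degree = d := by
    by_contra h
    exact (mem_support_iff.mp hm) (IsHomogeneous.coeff_eq_zero hg h)
  have : ∑ i ∈ m.support, m i = d := hm'
  simp only [mul_pow, Finset.prod_mul_distrib, Finset.prod_pow_eq_pow_sum, this]
  ring

theorem eval_mul_const {d : ℕ} {g : MvPolynomial (Fin 3) ℂ} (hg : g ∈ Form d)
    (v : Fin 3 → ℂ) (t : ℂ) : eval (fun i => v i * t) g = eval v g * t ^ d := by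
  simpa [MvPolynomial.aeval_eq_eval] using aeval_mul_const hg v t

theorem mem_pointIdeal {d : ℕ} {g : MvPolynomial (Fin 3) ℂ} (hg : g ∈ Form d) (P : Plane) :
    g ∈ pointIdeal P ↔ eval P.rep g = 0 := by
  rw [pointIdeal, RingHom.mem_ker]
  have h := aeval_mul_const hg (fun i => Polynomial.C (P.rep i)) Polynomial.X
  have h2 : aeval (fun i => Polynomial.C (P.rep i)) g = Polynomial.C (eval P.rep g) := by
    have := MvPolynomial.aeval_algebraMap_apply (B := Polynomial ℂ) P.rep g
    simpa [MvPolynomial.aeval_eq_eval, Function.comp_def] using this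
  change aeval (fun i => Polynomial.C (P.rep i) * Polynomial.X) g = 0 ↔ _
  rw [h, h2]
  simp

theorem finrank_form (d : ℕ) : Module.finrank ℂ (Form d) = (d + 2).choose 2 := by
  have hs : {m : Fin 3 →₀ ℕ | m.degree = d}
      = ((Finset.univ : Finset (Fin 3)).finsuppAntidiag d : Set (Fin 3 →₀ ℕ)) := by
    ext m
    simp [Finset.mem_finsuppAntidiag, Finsupp.degree_eq_sum]
  rw [Form, homogeneousSubmodule_eq_finsupp_supported, AddMonoidAlgebra.supported_eq_map,
    LinearEquiv.finrank_map_eq, hs, (Finsupp.supportedEquivFinsupp (M := ℂ) (R := ℂ) _).finrank_eq,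
    Module.finrank_finsupp_self]
  rw [← Nat.card_eq_fintype_card, Nat.card_coe_set_eq, Set.ncard_coe_finset,
    Finset.card_finsuppAntidiag_nat_eq_choose, Finset.card_univ,
    Fintype.card_fin, show 3 + d - 1 = d + 2 by omega, ← Nat.choose_symm_add]

instance (d : ℕ) : Module.Finite ℂ (Form d) :=
  Module.Finite.iff_fg.mpr (homogeneousSubmodule_fg (Fin 3) ℂ d)

theorem eq_zero_of_dvd_form {f : Form 4} {d : ℕ} (hd : d < 4)
    {g : MvPolynomial (Fin 3) ℂ} (hg : g ∈ Form d) (h : f.1 ∣ g) : g = 0 := by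
  by_contra h0
  obtain ⟨k, rfl⟩ := h
  have h1 := IsHomogeneous.totalDegree hg h0
  have hf0 : f.1 ≠ 0 := left_ne_zero_of_mul h0
  rw [totalDegree_mul_of_isDomain hf0 (right_ne_zero_of_mul h0),
    IsHomogeneous.totalDegree f.2 hf0] at h1
  omega

/-! ### Irreducibility of smooth quartics -/

/-- The chain 0 ⊂ (x) ⊂ (x, y) ⊂ (x, y, z), with the ideals written as kernels of substitutions into
domains so that primality is immediate. -/
theorem three_le_height_of_zero :
    3 ≤ (RingHom.ker (aeval (0 : Fin 3 → ℂ) :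
      MvPolynomial (Fin 3) ℂ →ₐ[ℂ] ℂ)).height := by
  let φ₁ : MvPolynomial (Fin 3) ℂ →ₐ[ℂ] MvPolynomial (Fin 3) ℂ := aeval ![0, X 1, X 2]
  let φ₂ : MvPolynomial (Fin 3) ℂ →ₐ[ℂ] MvPolynomial (Fin 3) ℂ := aeval ![0, 0, X 2]
  let φ₃ : MvPolynomial (Fin 3) ℂ →ₐ[ℂ] ℂ := aeval (0 : Fin 3 → ℂ)
  have i₁ : (RingHom.ker φ₁).IsPrime := RingHom.ker_isPrime _
  have i₂ : (RingHom.ker φ₂).IsPrime := RingHom.ker_isPrime _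
  have i₃ : (RingHom.ker φ₃).IsPrime := RingHom.ker_isPrime _
  have h21 : φ₂ = (aeval ![0, 0, X 2]).comp φ₁ := by
    ext i; fin_cases i <;> simp [φ₁, φ₂]
  have h32 : φ₃ = (aeval (0 : Fin 3 → ℂ)).comp φ₂ := by
    ext i; fin_cases i <;> simp [φ₂, φ₃]
  have l₁ : (⊥ : Ideal (MvPolynomial (Fin 3) ℂ)) < RingHom.ker φ₁ := by
    refine bot_lt_iff_ne_bot.mpr fun h => ?_
    have : (X 0 : MvPolynomial (Fin 3) ℂ) ∈ RingHom.ker φ₁ := by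
      simp [RingHom.mem_ker, φ₁]
    rw [h] at this
    simp at this
  have l₂ : RingHom.ker φ₁ < RingHom.ker φ₂ := by
    refine lt_of_le_of_ne (fun g hg => ?_) fun h => ?_
    · rw [RingHom.mem_ker] at hg ⊢
      rw [h21, AlgHom.comp_apply, hg, map_zero]
    · have : (X 1 : MvPolynomial (Fin 3) ℂ) ∈ RingHom.ker φ₂ := by
        simp [RingHom.mem_ker, φ₂]
      rw [← h, RingHom.mem_ker] at this
      simp [φ₁] at this
  have l₃ : RingHom.ker φ₂ < RingHom.ker φ₃ := by
    refine lt_of_le_of_ne (fun g hg => ?_) fun h => ?_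
    · rw [RingHom.mem_ker] at hg ⊢
      rw [h32, AlgHom.comp_apply, hg, map_zero]
    · have : (X 2 : MvPolynomial (Fin 3) ℂ) ∈ RingHom.ker φ₃ := by
        simp [RingHom.mem_ker, φ₃]
      rw [← h, RingHom.mem_ker] at this
      simp [φ₂] at this
  have e₁ := Ideal.height_add_one_le_of_lt_of_isPrime l₁
  have e₂ := Ideal.height_add_one_le_of_lt_of_isPrime l₂
  have e₃ := Ideal.height_add_one_le_of_lt_of_isPrime l₃
  calc (3 : ℕ∞) = 0 + 1 + 1 + 1 := by norm_num
    _ ≤ (⊥ : Ideal (MvPolynomial (Fin 3) ℂ)).height + 1 + 1 + 1 := by gcongr; exact zero_le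
    _ ≤ _ := le_trans (by gcongr; exact le_trans (by gcongr) e₂) e₃

/-- If the origin were the only common zero, the Nullstellensatz would make its maximal ideal
minimal over an ideal with two generators. Krull's height theorem would then bound its height by 2.
-/
theorem exists_common_zero {g h : MvPolynomial (Fin 3) ℂ}
    (hg : eval 0 g = 0) (hh : eval 0 h = 0) :
    ∃ v : Fin 3 → ℂ, v ≠ 0 ∧ eval v g = 0 ∧ eval v h = 0 := by
  by_contra! hc
  set m := RingHom.ker (aeval (0 : Fin 3 → ℂ) : MvPolynomial (Fin 3) ℂ →ₐ[ℂ] ℂ)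
  have hm : m.IsPrime := RingHom.ker_isPrime _
  set I : Ideal (MvPolynomial (Fin 3) ℂ) := Ideal.span {g, h}
  have hI : I ≤ m := by
    rw [Ideal.span_le]
    rintro k (rfl | rfl)
    · simpa [m, RingHom.mem_ker, aeval_eq_eval] using hg
    · simpa [m, RingHom.mem_ker, aeval_eq_eval] using hh
  have hrad : m ≤ I.radical := by
    rw [← vanishingIdeal_zeroLocus_eq_radical (K := ℂ)]
    intro k hk
    rw [mem_vanishingIdeal_iff]
    intro v hv
    rw [mem_zeroLocus_iff] at hv
    have h1 := hv g (Ideal.subset_span (by simp))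
    have h2 := hv h (Ideal.subset_span (by simp))
    simp only [aeval_eq_eval] at h1 h2
    have hv0 : v = 0 := by
      by_contra hne
      exact hc v hne h1 h2
    subst hv0
    exact hk
  have hmin : m ∈ I.minimalPrimes := by
    refine ⟨⟨hm, hI⟩, fun q hq _ => ?_⟩
    exact hrad.trans (hq.1.radical_le_iff.mpr hq.2)
  have h2 := Ideal.height_le_card_of_mem_minimalPrimes_span (Set.toFinite {g, h}) hmin
  have h3 := three_le_height_of_zero
  have h4 : (({g, h} : Set (MvPolynomial (Fin 3) ℂ)).ncard : ℕ∞) ≤ 2 := by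
    have := Set.ncard_insert_le g {h}
    rw [Set.ncard_singleton] at this
    exact_mod_cast this
  exact absurd (h3.trans (h2.trans h4)) (by norm_num)

/-- On the line through 0 and a point `v` with `f(v) ≠ 0`, the restriction of `h` divides a nonzero
multiple of `X ^ 4`. As `h(0) ≠ 0`, it is constant there. -/
theorem isUnit_of_mul_form {f : Form 4} (hf0 : f.1 ≠ 0) {g h : MvPolynomial (Fin 3) ℂ}
    (e : f.1 = g * h) (hh : eval 0 h ≠ 0) : IsUnit h := by
  -- The factor `f` takes care of the points where `f` vanishes, about which the argument on lines
  -- says nothing.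
  have key : f.1 * (h - C (eval 0 h)) = 0 := by
    refine MvPolynomial.funext fun v => ?_
    simp only [map_mul, map_sub, eval_C, map_zero, mul_eq_zero, sub_eq_zero]
    by_contra! hv
    let ψ : MvPolynomial (Fin 3) ℂ →ₐ[ℂ] Polynomial ℂ :=
      aeval fun i => Polynomial.C (v i) * Polynomial.X
    have hev (t : ℂ) (k : MvPolynomial (Fin 3) ℂ) :
        (ψ k).eval t = eval (fun i => v i * t) k := by
      have : (Polynomial.aeval t).comp ψ = aeval (fun i => v i * t) := by
        ext i; simp [ψ]
      have := DFunLike.congr_fun this k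
      simpa [aeval_eq_eval] using this
    have hfψ : ψ f.1 = Polynomial.C (eval v f.1) * Polynomial.X ^ 4 := by
      refine Polynomial.funext fun t => ?_
      rw [hev, eval_mul_const f.2]
      simp
    have hdvd : ψ h ∣ Polynomial.X ^ 4 := by
      have h1 : ψ h ∣ Polynomial.C (eval v f.1) * Polynomial.X ^ 4 := by
        rw [← hfψ, e, map_mul]; exact dvd_mul_left _ _
      exact (((Polynomial.isUnit_C.mpr (isUnit_iff_ne_zero.mpr hv.1)).dvd_mul_left).mp h1)
    obtain ⟨n, -, hn⟩ := (dvd_prime_pow Polynomial.prime_X 4).mp hdvd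
    obtain ⟨u, hu⟩ := hn.symm
    obtain ⟨c, hc⟩ := Polynomial.isUnit_iff.mp u.isUnit
    rw [← hc.2] at hu
    have e0 := hev 0 h
    have e1 := hev 1 h
    rw [← hu] at e0 e1
    simp only [mul_zero, mul_one, Polynomial.eval_mul, Polynomial.eval_pow, Polynomial.eval_X,
      Polynomial.eval_C, one_pow, one_mul] at e0 e1
    have hz : (fun _ => 0 : Fin 3 → ℂ) = 0 := rfl
    rw [hz] at e0
    have hn0 : n = 0 := by
      by_contra hn0
      rw [zero_pow hn0, zero_mul] at e0
      exact hh e0.symm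
    subst hn0
    rw [pow_zero, one_mul] at e0
    exact hv.2 (e1.symm.trans e0)
  have h1 := (mul_eq_zero.mp key).resolve_left hf0
  rw [sub_eq_zero.mp h1]
  exact (isUnit_iff_ne_zero.mpr hh).map C

theorem IsSmooth.ne_zero {f : Form 4} (hf : IsSmooth f) : f.1 ≠ 0 := by
  intro h
  obtain ⟨i, hi⟩ := hf (fun _ => 1) (fun h => one_ne_zero (congrFun h 0)) (by simp [h])
  simp [h] at hi

/-- Two nonunit factors vanish at 0, hence share a nonzero zero, and by the Leibniz rule all partial
derivatives of the product vanish there. -/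
theorem IsSmooth.prime {f : Form 4} (hf : IsSmooth f) : Prime f.1 := by
  refine Irreducible.prime ⟨fun hu => ?_, fun g h e => ?_⟩
  · have h0 : eval (fun i => (0 : Fin 3 → ℂ) i * 0) f.1 = 0 := by
      rw [eval_mul_const f.2]; simp
    exact (hu.map (eval _)).ne_zero h0
  · by_contra! hc
    have hh : eval 0 h = 0 := by
      by_contra hh
      exact hc.2 (isUnit_of_mul_form hf.ne_zero e hh)
    have hg : eval 0 g = 0 := by
      by_contra hg
      exact hc.1 (isUnit_of_mul_form hf.ne_zero (e.trans (mul_comm _ _)) hg)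
    obtain ⟨v, hv, h1, h2⟩ := exists_common_zero hg hh
    obtain ⟨i, hi⟩ := hf v hv (by rw [e, map_mul, h1, zero_mul])
    apply hi
    rw [e, Derivation.leibniz]
    simp [h1, h2]

/-! ### Binary forms -/

/-- The binary form in `U` and `V` of degree `n` with the coefficients of `p`. -/
def binary (U V : MvPolynomial (Fin 3) ℂ) (n : ℕ) (p : Polynomial ℂ) : MvPolynomial (Fin 3) ℂ :=
  ∑ i ∈ Finset.range (n + 1), C (p.coeff i) * (U ^ i * V ^ (n - i))

theorem binary_add (U V : MvPolynomial (Fin 3) ℂ) (n : ℕ) (p q : Polynomial ℂ) :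
    binary U V n (p + q) = binary U V n p + binary U V n q := by
  simp [binary, add_mul, Finset.sum_add_distrib]

theorem binary_C_mul (U V : MvPolynomial (Fin 3) ℂ) (n : ℕ) (c : ℂ) (p : Polynomial ℂ) :
    binary U V n (Polynomial.C c * p) = C c * binary U V n p := by
  simp [binary, Finset.mul_sum, mul_assoc]

theorem binary_X_mul (U V : MvPolynomial (Fin 3) ℂ) (n : ℕ) (p : Polynomial ℂ) :
    binary U V (n + 1) (Polynomial.X * p) = U * binary U V n p := by
  rw [binary, Finset.sum_range_succ', binary, Finset.mul_sum]
  simp only [Polynomial.coeff_X_mul, Polynomial.coeff_X_mul_zero, map_zero, zero_mul, add_zero]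
  refine Finset.sum_congr rfl fun i _ => ?_
  rw [Nat.add_sub_add_right]
  ring

theorem binary_succ (U V : MvPolynomial (Fin 3) ℂ) (n : ℕ) {p : Polynomial ℂ}
    (hp : p.natDegree ≤ n) : binary U V (n + 1) p = V * binary U V n p := by
  rw [binary, Finset.sum_range_succ, Polynomial.coeff_eq_zero_of_natDegree_lt (by omega),
    binary, Finset.mul_sum]
  simp only [map_zero, zero_mul, add_zero]
  refine Finset.sum_congr rfl fun i hi => ?_
  rw [Finset.mem_range] at hi
  rw [show n + 1 - i = (n - i) + 1 by omega]
  ring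

/-- Splitting of polynomials over ℂ, homogenized. A degree of `p` below `n` is a root at infinity
and contributes the factor `V`. -/
theorem exists_binary_eq_prod (U V : Form 1) (n : ℕ) (p : Polynomial ℂ) (hp : p.natDegree ≤ n) :
    ∃ (c : ℂ) (s : Multiset (Form 1)), s.card = n ∧
      binary U.1 V.1 n p = C c * (s.map Subtype.val).prod := by
  induction n generalizing p with
  | zero => exact ⟨p.coeff 0, 0, rfl, by simp [binary]⟩
  | succ n ih =>
    by_cases h : p.natDegree ≤ n
    · obtain ⟨c, s, hs, e⟩ := ih p h
      refine ⟨c, V ::ₘ s, by simp [hs], ?_⟩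
      rw [binary_succ _ _ _ h, e, Multiset.map_cons, Multiset.prod_cons]
      ring
    · have hdeg : p.natDegree = n + 1 := by omega
      have hp0 : p.degree ≠ 0 := fun h0 => by
        have := Polynomial.natDegree_eq_zero_iff_degree_le_zero.mpr h0.le
        omega
      obtain ⟨r, hr⟩ := IsAlgClosed.exists_root p hp0
      obtain ⟨q, rfl⟩ := Polynomial.dvd_iff_isRoot.mpr hr
      have hq : q ≠ 0 := by rintro rfl; simp at hdeg
      rw [Polynomial.natDegree_mul (Polynomial.X_sub_C_ne_zero r) hq,
        Polynomial.natDegree_X_sub_C] at hdeg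
      obtain ⟨c, s, hs, e⟩ := ih q (by omega)
      refine ⟨c, (U - r • V) ::ₘ s, by simp [hs], ?_⟩
      have : (Polynomial.X - Polynomial.C r) * q
          = Polynomial.X * q + Polynomial.C (-r) * q := by
        rw [Polynomial.C_neg]; ring
      rw [this, binary_add, binary_C_mul, binary_X_mul, binary_succ _ _ _ (by omega), e,
        Multiset.map_cons, Multiset.prod_cons]
      simp only [Submodule.coe_sub, Submodule.coe_smul, smul_eq_C_mul, map_neg]
      ring

/-- The space of binary forms in `U` and `V` of degree `n`. -/
def binaryForms (U V : MvPolynomial (Fin 3) ℂ) (n : ℕ) : Submodule ℂ (MvPolynomial (Fin 3) ℂ) where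
  carrier := {q | ∃ p : Polynomial ℂ, p.natDegree ≤ n ∧ q = binary U V n p}
  add_mem' := by
    rintro _ _ ⟨p, hp, rfl⟩ ⟨q, hq, rfl⟩
    exact ⟨p + q, (Polynomial.natDegree_add_le p q).trans (max_le hp hq), (binary_add ..).symm⟩
  zero_mem' := ⟨0, by simp, by simp [binary]⟩
  smul_mem' := by
    rintro c _ ⟨p, hp, rfl⟩
    exact ⟨Polynomial.C c * p, (Polynomial.natDegree_C_mul_le c p).trans hp, by
      rw [binary_C_mul, smul_eq_C_mul]⟩

theorem span_pow_le_binaryForms (U V : MvPolynomial (Fin 3) ℂ) (n : ℕ) :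
    Submodule.span ℂ {U, V} ^ n ≤ binaryForms U V n := by
  induction n with
  | zero =>
    rw [pow_zero, Submodule.one_le]
    exact ⟨1, by simp, by simp [binary]⟩
  | succ n ih =>
    rw [pow_succ', Submodule.mul_le]
    intro a ha b hb
    obtain ⟨c, d, rfl⟩ := Submodule.mem_span_pair.mp ha
    obtain ⟨p, hp, rfl⟩ := ih hb
    refine ⟨Polynomial.C c * (Polynomial.X * p) + Polynomial.C d * p, ?_, ?_⟩
    · refine (Polynomial.natDegree_add_le _ _).trans (max_le ?_ ?_)
      · refine (Polynomial.natDegree_C_mul_le _ _).trans ?_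
        refine Polynomial.natDegree_mul_le.trans ?_
        rw [Polynomial.natDegree_X]; omega
      · exact (Polynomial.natDegree_C_mul_le _ _).trans (by omega)
    · rw [binary_add, binary_C_mul, binary_C_mul, binary_X_mul, binary_succ _ _ _ hp]
      simp only [smul_eq_C_mul]
      ring

/-- Modulo a nonzero linear form, a form is a product of linear forms. -/
theorem exists_prod_linear_mod (L : Form 1) (hL : L ≠ 0) {d : ℕ} (g : Form (1 + d)) :
    ∃ (h : Form d) (c : ℂ) (s : Multiset (Form 1)), s.card = 1 + d ∧
      g.1 = L.1 * h.1 + C c * (s.map Subtype.val).prod := by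
  have hLX : L.1 ∈ Submodule.span ℂ (Set.range (X : Fin 3 → MvPolynomial (Fin 3) ℂ)) := by
    rw [← homogeneousSubmodule_one_eq_span_X]; exact L.2
  obtain ⟨l, hl⟩ := (Submodule.mem_span_range_iff_exists_fun ℂ).mp hLX
  have hl0 : ∃ i, l i ≠ 0 := by
    by_contra! h
    apply hL
    ext1
    rw [← hl]
    simp [h]
  obtain ⟨i, hi⟩ := hl0
  obtain ⟨j, k, hjk⟩ : ∃ j k : Fin 3, j ≠ i ∧ k ≠ i ∧ j ≠ k ∧ ∀ m, m ≠ i → m = j ∨ m = k := by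
    fin_cases i
    · exact ⟨1, 2, by decide⟩
    · exact ⟨0, 2, by decide⟩
    · exact ⟨0, 1, by decide⟩
  obtain ⟨hji, hki, hjk', hall⟩ := hjk
  have hsum : L.1 = l i • X i + l j • X j + l k • X k := by
    rw [← hl, ← Finset.sum_subset (Finset.subset_univ {i, j, k})]
    · rw [Finset.sum_insert (by simp [hji.symm, hki.symm]), Finset.sum_insert (by simp [hjk'])]
      simp [add_assoc]
    · intro m _ hm
      simp only [Finset.mem_insert, Finset.mem_singleton, not_or] at hm
      exact absurd (hall m hm.1) (by simp [hm.2.1, hm.2.2])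
  set S := Submodule.span ℂ {(X j : MvPolynomial (Fin 3) ℂ), X k}
  -- `w` is the value of `X i` modulo `L`, so `σ` eliminates `X i` and leaves a binary form in `X j`
  -- and `X k`.
  let w : MvPolynomial (Fin 3) ℂ := -((l j / l i) • X j + (l k / l i) • X k)
  let σ : MvPolynomial (Fin 3) ℂ →ₐ[ℂ] MvPolynomial (Fin 3) ℂ :=
    aeval fun m => if m = i then w else X m
  have hw : w ∈ S := by
    refine neg_mem (add_mem (Submodule.smul_mem _ _ ?_) (Submodule.smul_mem _ _ ?_)) <;>
    exact Submodule.subset_span (by simp)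
  have hσ : σ g.1 ∈ S ^ (1 + d) := by
    have h1 : g.1 ∈ Form 1 ^ (1 + d) := by
      rw [homogeneousSubmodule_one_pow]; exact g.2
    have h2 : (Form 1).map σ.toLinearMap ≤ S := by
      rw [Form, homogeneousSubmodule_one_eq_span_X, Submodule.map_span_le]
      rintro _ ⟨m, rfl⟩
      simp only [AlgHom.toLinearMap_apply, σ, aeval_X]
      split_ifs with hm
      · exact hw
      · exact Submodule.subset_span (by rcases hall m hm with rfl | rfl <;> simp)
    have h3 : σ g.1 ∈ (Form 1 ^ (1 + d)).map σ.toLinearMap := Submodule.mem_map_of_mem h1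
    rw [Submodule.map_pow] at h3
    exact pow_le_pow_left' h2 _ h3
  obtain ⟨p, hp, e⟩ := span_pow_le_binaryForms _ _ _ hσ
  obtain ⟨c, s, hs, e'⟩ := exists_binary_eq_prod ⟨X j, isHomogeneous_X ℂ j⟩
    ⟨X k, isHomogeneous_X ℂ k⟩ (1 + d) p hp
  have hdvd : L.1 ∣ g.1 - σ g.1 := by
    rw [← Ideal.mem_span_singleton, ← Ideal.Quotient.eq]
    have : (Ideal.Quotient.mkₐ ℂ (Ideal.span {L.1})) =
        (Ideal.Quotient.mkₐ ℂ (Ideal.span {L.1})).comp σ := by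
      ext m
      simp only [AlgHom.comp_apply, σ, aeval_X, Ideal.Quotient.mkₐ_eq_mk]
      split_ifs with hm
      · subst hm
        rw [Ideal.Quotient.eq, Ideal.mem_span_singleton]
        refine ⟨C (l m)⁻¹, ?_⟩
        have hC : (C (l m) * C (l m)⁻¹ : MvPolynomial (Fin 3) ℂ) = 1 := by
          rw [← C_mul, mul_inv_cancel₀ hi, C_1]
        simp only [hsum, w, smul_eq_C_mul, div_eq_mul_inv, C_mul]
        linear_combination (-X m) * hC
      · rfl
    exact DFunLike.congr_fun this g.1
  have hprod : C c * (s.map Subtype.val).prod ∈ Form (1 + d) := by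
    rw [← e', ← e]
    have := IsHomogeneous.aeval g.2 (fun m => if m = i then w else X m) (n := 1) (fun m => by
      split_ifs
      · have : w ∈ Form 1 := neg_mem (add_mem (Submodule.smul_mem _ _ (isHomogeneous_X ℂ j))
          (Submodule.smul_mem _ _ (isHomogeneous_X ℂ k)))
        exact this
      · exact isHomogeneous_X ℂ m)
    rw [one_mul] at this
    exact this
  rw [e, e'] at hdvd
  obtain ⟨h, hh⟩ := exists_form_of_dvd L (sub_mem g.2 hprod) hdvd
  exact ⟨h, c, s, hs, by rw [← hh]; ring⟩

/-! ### Germs of forms -/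

theorem germ_mul {d e n : ℕ} {P : Plane} (g : Form d) (h : Form e) (k : Form n) (hn : n = d + e)
    (hk : k.1 = g.1 * h.1) : germ k P = germ g P * germ h P := by
  subst hn
  rw [HomogeneousLocalization.ext_iff_val, HomogeneousLocalization.val_mul]
  simp only [germ, HomogeneousLocalization.val_mk, hk, Localization.mk_mul]
  congr 1
  ext1
  simp [pow_add]

theorem germ_add {d : ℕ} {P : Plane} (g h : Form d) :
    germ (g + h) P = germ g P + germ h P := by
  rw [HomogeneousLocalization.ext_iff_val, HomogeneousLocalization.val_add]
  simp only [germ, HomogeneousLocalization.val_mk, Localization.add_mk_self]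
  rfl

theorem germ_zero {d : ℕ} {P : Plane} : germ (0 : Form d) P = 0 :=
  HomogeneousLocalization.mk_eq_zero_of_num _ rfl

theorem isUnit_germ_iff {d : ℕ} {P : Plane} (g : Form d) :
    IsUnit (germ g P) ↔ eval P.rep g.1 ≠ 0 := by
  rw [← HomogeneousLocalization.isUnit_iff_isUnit_val]
  simp only [germ, HomogeneousLocalization.val_mk, Localization.mk_eq_mk']
  rw [IsLocalization.AtPrime.isUnit_mk'_iff (Localization.AtPrime (pointIdeal P)) (pointIdeal P),
    Ideal.mem_primeCompl_iff, mem_pointIdeal g.2]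

theorem exists_mul_germ_eq {P : Plane} (a : PlaneLocalRing P) :
    ∃ (d : ℕ) (g s : Form d), eval P.rep s.1 ≠ 0 ∧ a * germ s P = germ g P := by
  obtain ⟨⟨d, g, s, hs⟩, rfl⟩ := HomogeneousLocalization.mk_surjective a
  refine ⟨d, g, s, fun h => hs ((mem_pointIdeal s.2 P).mpr h), ?_⟩
  rw [HomogeneousLocalization.ext_iff_val, HomogeneousLocalization.val_mul]
  simp only [germ, HomogeneousLocalization.val_mk, Localization.mk_mul]
  rw [Localization.mk_eq_mk_iff, Localization.r_iff_exists]
  exact ⟨1, by simp; ring⟩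

/-- The germ on `C` of a form. -/
def curveGerm (f : Form 4) (P : Point f) {d : ℕ} (g : Form d) : CurveLocalRing f P :=
  Ideal.Quotient.mk _ (germ g P.1)

section Germs

variable {f : Form 4} (P : Point f)

theorem mult_eq_ord {d : ℕ} (g : Form d) :
    mult f g P = Ring.ord (CurveLocalRing f P) (curveGerm f P g) := rfl

theorem curveGerm_mul {d e n : ℕ} (g : Form d) (h : Form e) (k : Form n) (hn : n = d + e)
    (hk : k.1 = g.1 * h.1) : curveGerm f P k = curveGerm f P g * curveGerm f P h := by
  rw [curveGerm, germ_mul g h k hn hk, map_mul]; rfl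

theorem curveGerm_add {d : ℕ} (g h : Form d) :
    curveGerm f P (g + h) = curveGerm f P g + curveGerm f P h := by
  rw [curveGerm, germ_add, map_add]; rfl

theorem curveGerm_zero {d : ℕ} : curveGerm f P (0 : Form d) = 0 := by
  rw [curveGerm, germ_zero, map_zero]

theorem curveGerm_smul {d : ℕ} (c : ℂ) (g : Form d) :
    curveGerm f P (c • g) = curveGerm f P (Form.const c) * curveGerm f P g :=
  curveGerm_mul P _ _ _ (zero_add d).symm (smul_eq_C_mul _ _)

theorem curveGerm_self : curveGerm f P f = 0 :=
  Ideal.Quotient.eq_zero_iff_mem.mpr (Ideal.mem_span_singleton_self _)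

theorem germ_self_mem_maximalIdeal :
    Ideal.span {germ f P.1} ≤ IsLocalRing.maximalIdeal (PlaneLocalRing P.1) := by
  rw [Ideal.span_singleton_le_iff_mem, IsLocalRing.mem_maximalIdeal, mem_nonunits_iff,
    isUnit_germ_iff, not_not]
  exact P.2

instance : Nontrivial (CurveLocalRing f P) :=
  Ideal.Quotient.nontrivial_iff.mpr fun h => by
    have := germ_self_mem_maximalIdeal P
    rw [h, top_le_iff] at this
    exact (IsLocalRing.maximalIdeal.isMaximal _).ne_top this

theorem isUnit_curveGerm_iff {d : ℕ} (g : Form d) :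
    IsUnit (curveGerm f P g) ↔ eval P.1.rep g.1 ≠ 0 := by
  rw [← isUnit_germ_iff]
  refine ⟨fun h => ?_, fun h => h.map _⟩
  by_contra hn
  obtain ⟨b, hb⟩ := isUnit_iff_exists_inv.mp h
  obtain ⟨b, rfl⟩ := Ideal.Quotient.mk_surjective b
  have h1 : germ g P.1 * b - 1 ∈ IsLocalRing.maximalIdeal (PlaneLocalRing P.1) := by
    refine germ_self_mem_maximalIdeal P ?_
    rw [← Ideal.Quotient.eq, map_mul, map_one]
    exact hb
  have h2 : germ g P.1 * b ∈ IsLocalRing.maximalIdeal (PlaneLocalRing P.1) :=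
    Ideal.mul_mem_right _ _ ((IsLocalRing.mem_maximalIdeal _).mpr hn)
  have h3 := sub_mem h2 h1
  rw [sub_sub_cancel] at h3
  exact (Ideal.ne_top_iff_one _).mp (IsLocalRing.maximalIdeal.isMaximal _).ne_top h3

/-- Up to the unit germ of `s`, every element of the local ring is the germ of a form. Local
questions thus reduce to divisibility of forms and values at `P`. -/
theorem exists_mul_curveGerm_eq (a : CurveLocalRing f P) :
    ∃ (d : ℕ) (g s : Form d), eval P.1.rep s.1 ≠ 0 ∧ a * curveGerm f P s = curveGerm f P g := by
  obtain ⟨a, rfl⟩ := Ideal.Quotient.mk_surjective a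
  obtain ⟨d, g, s, hs, h⟩ := exists_mul_germ_eq a
  exact ⟨d, g, s, hs, by rw [curveGerm, curveGerm, ← h, map_mul]⟩

theorem curveGerm_eq_zero_of_dvd {d : ℕ} {g : Form d} (h : f.1 ∣ g.1) :
    curveGerm f P g = 0 := by
  by_cases hd : d < 4
  · have : g = 0 := Subtype.ext (eq_zero_of_dvd_form hd g.2 h)
    rw [this, curveGerm_zero]
  · obtain ⟨e, rfl⟩ := Nat.exists_eq_add_of_le (not_lt.mp hd)
    obtain ⟨k, hk⟩ := exists_form_of_dvd f g.2 h
    rw [curveGerm_mul P f k g rfl hk, curveGerm_self, zero_mul]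

theorem not_dvd_of_eval_ne_zero {g : MvPolynomial (Fin 3) ℂ} (h : eval P.1.rep g ≠ 0) :
    ¬ f.1 ∣ g := by
  rintro ⟨k, rfl⟩
  rw [map_mul, P.2, zero_mul] at h
  exact h rfl

/-- Clearing denominators leaves `f` dividing a product of `g` with factors outside the ideal of the
point. Since `f` lies in that ideal and is prime, it divides `g`. -/
theorem curveGerm_eq_zero_iff (hf : Prime f.1) {d : ℕ} (g : Form d) :
    curveGerm f P g = 0 ↔ f.1 ∣ g.1 := by
  refine ⟨fun h => ?_, curveGerm_eq_zero_of_dvd P⟩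
  obtain ⟨a, ha⟩ := Ideal.mem_span_singleton.mp (Ideal.Quotient.eq_zero_iff_mem.mp h)
  obtain ⟨e, b, s, hs, hb⟩ := exists_mul_germ_eq a
  have h1 : germ (Form.mul g s) P.1 = germ (Form.mul f b) P.1 := by
    rw [germ_mul g s (Form.mul g s) rfl rfl, germ_mul f b (Form.mul f b) rfl rfl, ha, ← hb,
      mul_assoc]
  rw [HomogeneousLocalization.ext_iff_val] at h1
  simp only [germ, HomogeneousLocalization.val_mk] at h1
  rw [Localization.mk_eq_mk_iff, Localization.r_iff_exists] at h1
  obtain ⟨c, hc⟩ := h1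
  have hXne (n : ℕ) : eval P.1.rep (X (chart P.1) ^ n : MvPolynomial (Fin 3) ℂ) ≠ 0 := by
    simpa using pow_ne_zero n (chart_spec P.1)
  have hcne : ¬ f.1 ∣ c.1 := by
    rintro ⟨k, hk⟩
    refine c.2 ?_
    rw [hk]
    exact Ideal.mul_mem_right _ _ ((mem_pointIdeal f.2 _).mpr P.2)
  have h2 : f.1 ∣ c.1 * (X (chart P.1) ^ (4 + e) * (g.1 * s.1)) :=
    ⟨c.1 * (X (chart P.1) ^ (d + e) * b.1), by
      simp only [Form.mul] at hc
      rw [hc]; ring⟩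
  have h3 := (hf.dvd_or_dvd h2).resolve_left hcne
  have h4 := (hf.dvd_or_dvd h3).resolve_left (not_dvd_of_eval_ne_zero P (hXne _))
  exact (hf.dvd_or_dvd h4).resolve_right (not_dvd_of_eval_ne_zero P hs)

theorem curveLocalRing_isDomain (hf : Prime f.1) : IsDomain (CurveLocalRing f P) := by
  have : NoZeroDivisors (CurveLocalRing f P) := ⟨fun {a b} h => by
    obtain ⟨d, g, s, hs, hg⟩ := exists_mul_curveGerm_eq P a
    obtain ⟨e, g', s', hs', hg'⟩ := exists_mul_curveGerm_eq P b
    have h1 : curveGerm f P (Form.mul g g') = 0 := by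
      rw [curveGerm_mul P g g' _ rfl rfl, ← hg, ← hg']
      linear_combination curveGerm f P s * curveGerm f P s' * h
    rw [curveGerm_eq_zero_iff P hf] at h1
    rcases hf.dvd_or_dvd h1 with h2 | h2
    · left
      rw [curveGerm_eq_zero_of_dvd P h2] at hg
      exact (((isUnit_curveGerm_iff P s).mpr hs).mul_left_eq_zero).mp hg
    · right
      rw [curveGerm_eq_zero_of_dvd P h2] at hg'
      exact (((isUnit_curveGerm_iff P s').mpr hs').mul_left_eq_zero).mp hg'⟩
  exact NoZeroDivisors.to_isDomain _

/-! ### Local parameters -/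

/-- The linear form `v_i x_j - v_j x_i`, which vanishes at `v`. -/
def lineThrough (v : Fin 3 → ℂ) (i j : Fin 3) : Form 1 :=
  v i • ⟨X j, isHomogeneous_X ℂ j⟩ - v j • ⟨X i, isHomogeneous_X ℂ i⟩

theorem lineThrough_val (v : Fin 3 → ℂ) (i j : Fin 3) :
    (lineThrough v i j).1 = C (v i) * X j - C (v j) * X i := by
  simp [lineThrough, smul_eq_C_mul]

/-- Modulo the forms `v_i X_j - v_j X_i`, homogeneity turns `v_i ^ (1 + d) * g` into `g(v) * X_i ^
(1 + d) = 0`, and `v_i` is invertible. -/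
theorem exists_eq_sum_lineThrough {P : Plane} {d : ℕ} (g : Form (1 + d))
    (hg : eval P.rep g.1 = 0) :
    ∃ a : Fin 3 → Form d, g.1 = ∑ j, (lineThrough P.rep (chart P) j).1 * (a j).1 := by
  set i := chart P
  set v := P.rep
  have hi : v i ≠ 0 := chart_spec P
  set I : Ideal (MvPolynomial (Fin 3) ℂ) :=
    Ideal.span (Set.range fun j => (lineThrough v i j).1)
  have hmk (j : Fin 3) : Ideal.Quotient.mk I (C (v i) * X j) =
      Ideal.Quotient.mk I (C (v j) * X i) := by
    rw [Ideal.Quotient.eq, ← lineThrough_val]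
    exact Ideal.subset_span ⟨j, rfl⟩
  have h1 : g.1 ∈ I := by
    rw [← Ideal.Quotient.eq_zero_iff_mem]
    let φ := Ideal.Quotient.mkₐ ℂ I
    have e1 : aeval (fun j => φ (X j) * φ (C (v i))) g.1 = φ g.1 * φ (C (v i)) ^ (1 + d) := by
      rw [aeval_mul_const g.2]
      congr 1
      have : aeval (fun j => φ (X j)) = φ := by ext j; simp
      rw [this]
    have e2 : aeval (fun j => φ (X j) * φ (C (v i))) g.1 = 0 := by
      have : (fun j => φ (X j) * φ (C (v i))) = fun j => φ (C (v j)) * φ (X i) := by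
        funext j
        rw [mul_comm, ← map_mul, ← map_mul]
        exact hmk j
      rw [this, aeval_mul_const g.2]
      have : aeval (fun j => φ (C (v j))) g.1 = algebraMap ℂ _ (eval v g.1) := by
        have := MvPolynomial.aeval_algebraMap_apply (B := MvPolynomial (Fin 3) ℂ ⧸ I) v g.1
        simpa [MvPolynomial.aeval_eq_eval, Function.comp_def] using this
      rw [this, hg, map_zero, zero_mul]
    have e3 : φ g.1 * φ (C (v i)) ^ (1 + d) = 0 := e1.symm.trans e2
    exact ((((isUnit_iff_ne_zero.mpr hi).map C).map φ).pow (1 + d)).mul_left_eq_zero.mp e3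
  obtain ⟨b, hb⟩ := (Submodule.mem_span_range_iff_exists_fun (MvPolynomial (Fin 3) ℂ)).mp h1
  refine ⟨fun j => ⟨homogeneousComponent d (b j), homogeneousComponent_mem d (b j)⟩, ?_⟩
  rw [← homogeneousComponent_eq_self g.2, ← hb, map_sum]
  refine Finset.sum_congr rfl fun j _ => ?_
  rw [smul_eq_mul, mul_comm, homogeneousComponent_mul_form (lineThrough v i j).2]

theorem eval_lineThrough (P : Plane) (i j : Fin 3) :
    eval P.rep (lineThrough P.rep i j).1 = 0 := by
  rw [lineThrough_val]
  simp; ring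

theorem curveGerm_sum {d : ℕ} {ι : Type*} (s : Finset ι) (g : ι → Form d) :
    curveGerm f P (∑ i ∈ s, g i) = ∑ i ∈ s, curveGerm f P (g i) := by
  classical
  induction s using Finset.induction_on with
  | empty => simp [curveGerm_zero]
  | insert a s ha ih => rw [Finset.sum_insert ha, Finset.sum_insert ha, curveGerm_add, ih]

theorem curveGerm_eq_sum {d : ℕ} (g : Form (1 + d)) (l : Fin 3 → Form 1) (a : Fin 3 → Form d)
    (h : g.1 = ∑ j, (l j).1 * (a j).1) :
    curveGerm f P g = ∑ j, curveGerm f P (l j) * curveGerm f P (a j) := by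
  have : g = ∑ j, Form.mul (l j) (a j) := by
    ext1
    rw [h, AddSubmonoidClass.coe_finsetSum]
    rfl
  rw [this, curveGerm_sum]
  exact Finset.sum_congr rfl fun j _ => curveGerm_mul P _ _ _ rfl rfl

/-- At a point of a smooth quartic there is a line whose germ generates the maximal ideal. -/
theorem exists_local_parameter (hf : IsSmooth f) :
    ∃ T : Form 1, eval P.1.rep T.1 = 0 ∧ ∀ (d : ℕ) (g : Form d), eval P.1.rep g.1 = 0 →
      curveGerm f P T ∣ curveGerm f P g := by
  set v := P.1.rep
  set i := chart P.1
  have hi : v i ≠ 0 := chart_spec P.1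
  obtain ⟨a, ha⟩ := exists_eq_sum_lineThrough (d := 3) f P.2
  have hline0 : lineThrough v i i = 0 := by
    ext1; rw [lineThrough_val]; simp
  -- The lines vanish at `v`, so the derivatives of `f` there involve only the values `a j (v)`. The
  -- term `j = i` is zero, hence smoothness supplies another index.
  obtain ⟨j, hj⟩ : ∃ j, eval v (a j).1 ≠ 0 ∧ j ≠ i := by
    by_contra! hc
    obtain ⟨m, hm⟩ := hf v P.1.rep_nonzero P.2
    apply hm
    rw [ha]
    simp only [map_sum, Derivation.leibniz, smul_eq_mul, map_add, map_mul]
    refine Finset.sum_eq_zero fun j _ => ?_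
    rw [eval_lineThrough]
    by_cases h0 : eval v (a j).1 = 0
    · rw [h0]; ring
    · have := hc j h0
      subst this
      rw [hline0]
      simp
  obtain ⟨k, hki, hkj, hall⟩ : ∃ k, k ≠ i ∧ k ≠ j ∧ ∀ m, m = i ∨ m = j ∨ m = k := by
    have := hj.2
    generalize i = i at *
    generalize j = j at *
    clear * - this
    revert i j
    decide
  have huniv (F : Fin 3 → CurveLocalRing f P) : ∑ m, F m = F i + F j + F k := by
    rw [← Finset.sum_subset (Finset.subset_univ {i, j, k})]
    · rw [Finset.sum_insert (by simp [hj.2.symm, hki.symm]), Finset.sum_insert (by simp [hkj.symm])]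
      simp [add_assoc]
    · intro m _ hm
      have := hall m
      simp only [Finset.mem_insert, Finset.mem_singleton] at hm
      exact absurd this hm
  have hz : curveGerm f P (lineThrough v i i) = 0 := by rw [hline0, curveGerm_zero]
  -- The relation `f = 0` on C reads `line_j * a_j = -line_k * a_k`, and `a_j` is a unit at `P`.
  have hdj : curveGerm f P (lineThrough v i k) ∣ curveGerm f P (lineThrough v i j) := by
    have h1 := curveGerm_eq_sum P (d := 3) f _ a ha
    rw [curveGerm_self, huniv, hz, zero_mul, zero_add] at h1
    have h2 : curveGerm f P (lineThrough v i k) ∣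
        curveGerm f P (lineThrough v i j) * curveGerm f P (a j) :=
      ⟨-curveGerm f P (a k), by linear_combination -h1⟩
    exact ((isUnit_curveGerm_iff P (a j)).mpr hj.1).dvd_mul_right.mp h2
  refine ⟨lineThrough v i k, eval_lineThrough _ _ _, fun d g hg => ?_⟩
  rcases Nat.eq_zero_or_pos d with rfl | hd
  · have : g.1 = C (coeff 0 g.1) := by
      rw [← homogeneousComponent_zero, homogeneousComponent_eq_self g.2]
    rw [this, eval_C] at hg
    rw [hg, C_0] at this
    rw [show g = 0 from Subtype.ext this, curveGerm_zero]
    exact dvd_zero _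
  · obtain ⟨d, rfl⟩ := Nat.exists_eq_add_of_le hd
    obtain ⟨b, hb⟩ := exists_eq_sum_lineThrough g hg
    rw [curveGerm_eq_sum P g _ b hb, huniv, hz, zero_mul, zero_add]
    exact dvd_add (hdj.mul_right _) (dvd_mul_right _ _)

end Germs

/-! ### Orders of vanishing in terms of a local parameter -/

theorem ord_eq_one_of_dvd_nonunits {R : Type*} [CommRing R] {τ : R}
    (hτ : ¬ IsUnit τ) (h : ∀ r : R, ¬ IsUnit r → τ ∣ r) : Ring.ord R τ = 1 := by
  have hmax : (Ideal.span {τ}).IsMaximal := by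
    refine Ideal.isMaximal_iff.mpr ⟨fun h1 => hτ ?_, fun J x _ hx hxJ => ?_⟩
    · exact isUnit_of_dvd_one (Ideal.mem_span_singleton.mp h1)
    · have : IsUnit x := by
        by_contra hu
        exact hx (Ideal.mem_span_singleton.mpr (h x hu))
      exact (Ideal.eq_top_iff_one J).mp (Ideal.eq_top_of_isUnit_mem J hxJ this)
  rw [Ring.ord, Module.length_eq_one_iff,
    isSimpleModule_iff_isSimpleModule_of_algebraMap_surjective (S := R ⧸ Ideal.span {τ})
      Ideal.Quotient.mk_surjective]
  let : Field (R ⧸ Ideal.span {τ}) := Ideal.Quotient.field _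
  infer_instance

/-- For the largest `n` with `τ ^ n ∣ r` the cofactor is a unit, so the order is `n`. If there is no
largest `n`, then already `τ ^ k ∣ r`, so no Noetherian hypothesis enters. -/
theorem le_ord_iff_pow_dvd {R : Type*} [CommRing R] [IsDomain R] {τ : R} (hτ0 : τ ≠ 0)
    (hτ : ¬ IsUnit τ) (h : ∀ r : R, ¬ IsUnit r → τ ∣ r) (r : R) (k : ℕ) :
    (k : ℕ∞) ≤ Ring.ord R r ↔ τ ^ k ∣ r := by
  have h1 (n : ℕ) : Ring.ord R (τ ^ n) = n := by
    rw [Ring.ord_pow (mem_nonZeroDivisors_of_ne_zero hτ0), ord_eq_one_of_dvd_nonunits hτ h,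
      nsmul_one]
  refine ⟨fun hk => ?_, fun hk => (h1 k).symm.le.trans (Ring.ord_le_ord_of_dvd hk)⟩
  by_contra hn
  obtain ⟨n, ⟨a, ha⟩, hn'⟩ : ∃ n, τ ^ n ∣ r ∧ ¬ τ ^ (n + 1) ∣ r := by
    by_contra! hc
    exact hn (Nat.rec (by simp) (fun n ih => hc n ih) k)
  have hu : IsUnit a := by
    by_contra hu
    obtain ⟨b, rfl⟩ := h a hu
    exact hn' ⟨b, by rw [ha]; ring⟩
  rw [ha, Ring.ord_mul_of_isUnit_right hu, h1] at hk
  have hkn : k ≤ n := by exact_mod_cast hk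
  exact hn ((pow_dvd_pow τ hkn).trans ⟨a, ha⟩)

section Mult

variable {f : Form 4}

theorem exists_uniformizer (hf : IsSmooth f) (P : Point f) : ∃ T : Form 1,
    curveGerm f P T ≠ 0 ∧ ¬ IsUnit (curveGerm f P T) ∧
      ∀ r : CurveLocalRing f P, ¬ IsUnit r → curveGerm f P T ∣ r := by
  obtain ⟨T, hT, h⟩ := exists_local_parameter P hf
  refine ⟨T, fun h0 => ?_, by simpa [isUnit_curveGerm_iff] using hT, fun r hr => ?_⟩
  -- If the germ of `T` were zero, a nonzero line through `P` would vanish on C and be divisible by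
  -- the quartic.
  · obtain ⟨j, hj⟩ : ∃ j, j ≠ chart P.1 := exists_ne _
    have h1 := h 1 (lineThrough P.1.rep (chart P.1) j) (eval_lineThrough _ _ _)
    rw [h0, zero_dvd_iff, curveGerm_eq_zero_iff P hf.prime] at h1
    have h2 := eq_zero_of_dvd_form (by norm_num) (Subtype.prop _) h1
    have h3 := congrArg (eval (Pi.single j 1)) h2
    rw [lineThrough_val] at h3
    simp [Pi.single_eq_of_ne hj.symm, chart_spec] at h3
  · obtain ⟨d, g, s, hs, e⟩ := exists_mul_curveGerm_eq P r
    have hsu := (isUnit_curveGerm_iff P s).mpr hs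
    have hg : eval P.1.rep g.1 = 0 := by
      by_contra hg
      replace hg := (isUnit_curveGerm_iff P g).mpr hg
      rw [← e] at hg
      exact hr (isUnit_of_mul_isUnit_left hg)
    have h1 := h d g hg
    rw [← e] at h1
    exact hsu.dvd_mul_right.mp h1

theorem mult_eq_zero_of_eval_ne_zero (P : Point f) {d : ℕ} {g : Form d} (h : eval P.1.rep g.1 ≠ 0) :
    mult f g P = 0 :=
  Ring.ord_of_isUnit ((isUnit_curveGerm_iff P g).mpr h)

theorem exists_line_mult_eq_one (hf : IsSmooth f) (P : Point f) : ∃ T : Form 1, mult f T P = 1 := by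
  obtain ⟨T, -, h1, h2⟩ := exists_uniformizer hf P
  exact ⟨T, ord_eq_one_of_dvd_nonunits h1 h2⟩

theorem one_le_mult_iff (hf : IsSmooth f) (P : Point f) {d : ℕ} {g : Form d} :
    1 ≤ mult f g P ↔ eval P.1.rep g.1 = 0 := by
  have := curveLocalRing_isDomain P hf.prime
  obtain ⟨T, h0, h1, h2⟩ := exists_uniformizer hf P
  have h3 := le_ord_iff_pow_dvd h0 h1 h2 (curveGerm f P g) 1
  rw [pow_one] at h3
  constructor
  · intro h
    by_contra hn
    rw [mult_eq_zero_of_eval_ne_zero P hn] at h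
    exact absurd h (by norm_num)
  · intro h
    refine h3.mpr (h2 _ ?_)
    rw [isUnit_curveGerm_iff, not_not]
    exact h

theorem mult_eq_top_of_dvd (hf : IsSmooth f) (P : Point f) {d : ℕ} {g : Form d} (h : f.1 ∣ g.1) :
    mult f g P = ⊤ := by
  have := curveLocalRing_isDomain P hf.prime
  obtain ⟨T, h0, h1, h2⟩ := exists_uniformizer hf P
  refine ENat.eq_top_iff_forall_ge.mpr fun n => (le_ord_iff_pow_dvd h0 h1 h2 _ n).mpr ?_
  have := curveGerm_eq_zero_of_dvd P h
  rw [curveGerm] at this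
  rw [this]
  exact dvd_zero _

theorem mult_mul (hf : IsSmooth f) (P : Point f) {d e n : ℕ} (g : Form d) (h : Form e)
    (k : Form n) (hn : n = d + e)
    (hk : k.1 = g.1 * h.1) : mult f k P = mult f g P + mult f h P := by
  have := curveLocalRing_isDomain P hf.prime
  by_cases hh : f.1 ∣ h.1
  · rw [mult_eq_top_of_dvd hf P hh, mult_eq_top_of_dvd hf P (hk ▸ hh.mul_left _), add_top]
  · rw [mult_eq_ord, curveGerm_mul P g h k hn hk, Ring.ord_mul]
    · rfl
    · exact mem_nonZeroDivisors_of_ne_zero (by rwa [Ne, curveGerm_eq_zero_iff P hf.prime])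

theorem mult_eq_of_dvd_sub (P : Point f) {d : ℕ} {g h : Form d} (hd : f.1 ∣ g.1 - h.1) :
    mult f g P = mult f h P := by
  have h1 : curveGerm f P (g - h) = 0 := curveGerm_eq_zero_of_dvd P hd
  have h2 : curveGerm f P g = curveGerm f P h := by
    rw [← sub_add_cancel g h, curveGerm_add, h1, zero_add]
  rw [mult_eq_ord, h2, mult_eq_ord]

theorem le_mult_add (hf : IsSmooth f) (P : Point f) {d : ℕ} {g h : Form d} {k : ℕ}
    (hg : k ≤ mult f g P) (hh : k ≤ mult f h P) :
    k ≤ mult f (g + h) P := by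
  have := curveLocalRing_isDomain P hf.prime
  obtain ⟨T, h0, h1, h2⟩ := exists_uniformizer hf P
  rw [mult_eq_ord, le_ord_iff_pow_dvd h0 h1 h2] at hg hh ⊢
  rw [curveGerm_add]
  exact dvd_add hg hh

theorem mult_const (P : Point f) {c : ℂ} (hc : c ≠ 0) : mult f (Form.const c) P = 0 :=
  mult_eq_zero_of_eval_ne_zero P (by simpa [Form.const] using hc)

theorem mult_le_mult_smul (P : Point f) {d : ℕ} (c : ℂ) (g : Form d) :
    mult f g P ≤ mult f (c • g) P := by
  rw [mult_eq_ord, mult_eq_ord, curveGerm_smul]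
  exact Ring.ord_le_ord_mul _ _

/-- Vanishing to order `k + 1` is at most one linear condition on forms vanishing to order `k`. -/
theorem exists_smul_add_vanishing (hf : IsSmooth f) (P : Point f) {d : ℕ} {g h : Form d}
    {k : ℕ} (hg : k ≤ mult f g P)
    (hg' : ¬ (k + 1 : ℕ) ≤ mult f g P) (hh : k ≤ mult f h P) :
    ∃ c : ℂ, (k + 1 : ℕ) ≤ mult f (h - c • g) P := by
  have := curveLocalRing_isDomain P hf.prime
  obtain ⟨T, h0, h1, h2⟩ := exists_uniformizer hf P
  rw [mult_eq_ord, le_ord_iff_pow_dvd h0 h1 h2] at hg hh hg'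
  obtain ⟨a, ha⟩ := hg
  obtain ⟨b, hb⟩ := hh
  have hau : IsUnit a := by
    by_contra hu
    obtain ⟨r, rfl⟩ := h2 a hu
    exact hg' ⟨r, by rw [ha]; ring⟩
  obtain ⟨u, rfl⟩ := hau
  -- The fraction `p / s` represents the ratio of the leading coefficients of `h` and `g`; the
  -- constant sought is its value at `P`.
  obtain ⟨e, p, s, hs, hp⟩ := exists_mul_curveGerm_eq P (b * (↑u⁻¹ : CurveLocalRing f P))
  have hsu := (isUnit_curveGerm_iff P s).mpr hs
  set c : ℂ := eval P.1.rep p.1 / eval P.1.rep s.1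
  refine ⟨c, ?_⟩
  rw [mult_eq_ord, le_ord_iff_pow_dvd h0 h1 h2]
  have h3 : curveGerm f P T ∣ curveGerm f P (p + (-c) • s) := by
    refine h2 _ ?_
    rw [isUnit_curveGerm_iff, not_not]
    simp [c, smul_eq_C_mul, div_mul_cancel₀ _ hs]
  rw [curveGerm_add, curveGerm_smul, ← hp, ← add_mul, hsu.dvd_mul_right] at h3
  obtain ⟨r, hr⟩ := h3
  refine ⟨r * u, ?_⟩
  rw [show h - c • g = h + (-c) • g from
    Subtype.ext (by simp [sub_eq_add_neg]), curveGerm_add, curveGerm_smul, ha, hb]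
  have huu : (↑u⁻¹ : CurveLocalRing f P) * u = 1 := u.inv_mul
  linear_combination (curveGerm f P T ^ k * u) * hr - curveGerm f P T ^ k * b * huu

end Mult

open scoped Classical

/-! ### Forms with prescribed zeros -/

section Vanishing

variable {f : Form 4}

/-- The forms of degree `n` whose divisor on `C` is at least `s`. -/
def vanishing (hf : IsSmooth f) (n : ℕ) (s : Multiset (Point f)) : Submodule ℂ (Form n) where
  carrier := {h | ∀ P, (s.count P : ℕ∞) ≤ mult f h P}
  add_mem' hg hh P := le_mult_add hf P (hg P) (hh P)
  zero_mem' P := by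
    rw [mult_eq_top_of_dvd hf P (g := (0 : Form n)) (dvd_zero _)]
    exact le_top
  smul_mem' c g hg P := (hg P).trans (mult_le_mult_smul P c g)

theorem vanishing_cons_le (hf : IsSmooth f) (n : ℕ) (P : Point f) (s : Multiset (Point f)) :
    vanishing hf n (P ::ₘ s) ≤ vanishing hf n s := fun _ hg Q =>
  le_trans (by exact_mod_cast Multiset.count_le_count_cons Q P s) (hg Q)

theorem mem_vanishing_cons (hf : IsSmooth f) {n : ℕ} {P : Point f} {s : Multiset (Point f)}
    {h : Form n} (hh : h ∈ vanishing hf n s) (hP : (s.count P + 1 : ℕ) ≤ mult f h P) :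
    h ∈ vanishing hf n (P ::ₘ s) := by
  intro Q
  by_cases hQ : Q = P
  · subst hQ
    rwa [Multiset.count_cons_self]
  · rw [Multiset.count_cons_of_ne hQ]
    exact hh Q

theorem finrank_vanishing_le_succ (hf : IsSmooth f) (n : ℕ) (P : Point f)
    (s : Multiset (Point f)) :
    Module.finrank ℂ (vanishing hf n s) ≤ Module.finrank ℂ (vanishing hf n (P ::ₘ s)) + 1 := by
  by_cases hle : vanishing hf n s ≤ vanishing hf n (P ::ₘ s)
  · exact (Submodule.finrank_mono hle).trans (Nat.le_succ _)
  · obtain ⟨g, hg, hg'⟩ := Set.not_subset.mp hle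
    have hsup : vanishing hf n s ≤ vanishing hf n (P ::ₘ s) ⊔ Submodule.span ℂ {g} := by
      intro h hh
      obtain ⟨c, hc⟩ := exists_smul_add_vanishing hf P (hg P)
        (fun hk => hg' (mem_vanishing_cons hf hg hk)) (hh P)
      have h1 : h - c • g ∈ vanishing hf n (P ::ₘ s) :=
        mem_vanishing_cons hf (sub_mem hh (Submodule.smul_mem _ c hg)) hc
      have h2 : c • g ∈ Submodule.span ℂ {g} :=
        Submodule.smul_mem _ c (Submodule.mem_span_singleton_self g)
      have := Submodule.add_mem_sup h1 h2
      rwa [sub_add_cancel] at this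
    have h1 := Submodule.finrank_mono hsup
    have h2 := Submodule.finrank_add_le_finrank_add_finrank (vanishing hf n (P ::ₘ s))
      (Submodule.span ℂ {g})
    have h3 := finrank_span_le_card (R := ℂ) ({g} : Set (Form n))
    simp only [Set.toFinset_singleton, Finset.card_singleton] at h3
    omega

theorem finrank_form_le_vanishing (hf : IsSmooth f) (n : ℕ) (s : Multiset (Point f)) :
    Module.finrank ℂ (Form n) ≤ Module.finrank ℂ (vanishing hf n s) + s.card := by
  induction s using Multiset.induction_on with
  | empty =>
    have : vanishing hf n 0 = ⊤ := by
      rw [eq_top_iff]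
      intro h _ P
      simp
    rw [this, finrank_top]
    simp
  | cons P s ih =>
    have := finrank_vanishing_le_succ hf n P s
    rw [Multiset.card_cons]
    omega

theorem exists_line_through (hf : IsSmooth f) (P Q : Point f) :
    ∃ L : Form 1, 1 ≤ mult f L Q ∧ mult f L P = if P = Q then 1 else 0 := by
  by_cases h : P = Q
  · subst h
    obtain ⟨T, hT⟩ := exists_line_mult_eq_one hf P
    exact ⟨T, hT.symm.le, by simp [hT]⟩
  · obtain ⟨j, hj⟩ : ∃ j, eval P.1.rep (lineThrough Q.1.rep (chart Q.1) j).1 ≠ 0 := by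
      by_contra! hc
      apply h
      apply Subtype.ext
      rw [← P.1.mk_rep, ← Q.1.mk_rep, Projectivization.mk_eq_mk_iff']
      refine ⟨P.1.rep (chart Q.1) / Q.1.rep (chart Q.1), ?_⟩
      funext j
      have hj := hc j
      rw [lineThrough_val] at hj
      simp only [map_sub, map_mul, eval_C, eval_X] at hj
      have hne := chart_spec Q.1
      simp only [Pi.smul_apply, smul_eq_mul]
      field_simp
      linear_combination -hj
    refine ⟨_, (one_le_mult_iff hf Q).mpr (eval_lineThrough Q.1 (chart Q.1) j), ?_⟩
    rw [if_neg h, mult_eq_zero_of_eval_ne_zero P hj]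

/-- The form is a product of lines, one for each point of `s`, times a power of a coordinate that
does not vanish at `P`. The lines for points other than `P` avoid `P`, and those for `P` meet C
simply there. -/
theorem exists_vanishing_mult_eq (hf : IsSmooth f) (P : Point f) (s : Multiset (Point f)) (n : ℕ)
    (hn : s.card ≤ n) : ∃ h ∈ vanishing hf n s, mult f h P = s.count P := by
  induction s using Multiset.induction_on generalizing n with
  | empty =>
    refine ⟨⟨X (chart P.1) ^ n, X_chart_pow_form P.1 n⟩, fun Q => by simp, ?_⟩
    rw [mult_eq_zero_of_eval_ne_zero]
    · simp
    · simpa using pow_ne_zero n (chart_spec P.1)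
  | cons Q s ih =>
    rw [Multiset.card_cons, add_comm] at hn
    obtain ⟨m, rfl⟩ := Nat.exists_eq_add_of_le (le_trans (Nat.le_add_right 1 _) hn)
    obtain ⟨h, hh, hP⟩ := ih m (by omega)
    obtain ⟨L, hL, hLP⟩ := exists_line_through hf P Q
    have hmul (R : Point f) := mult_mul hf R L h (Form.mul L h) rfl rfl
    refine ⟨Form.mul L h, mem_vanishing_cons hf (fun R => ?_) ?_, ?_⟩
    · rw [hmul]
      exact (hh R).trans le_add_self
    · rw [hmul, Nat.cast_add, add_comm]
      exact add_le_add hL (hh Q)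
    · rw [hmul, hP, hLP, Multiset.count_cons]
      split_ifs <;> simp [add_comm]

/-- In degree at least `s.card` the conditions are independent: each added point excludes a form
whose multiplicity there is exactly the one already imposed. -/
theorem finrank_vanishing_add_card (hf : IsSmooth f) (n : ℕ) (s : Multiset (Point f))
    (hn : s.card ≤ n) :
    Module.finrank ℂ (vanishing hf n s) + s.card ≤ Module.finrank ℂ (Form n) := by
  induction s using Multiset.induction_on with
  | empty => simpa using Submodule.finrank_le _
  | cons P s ih =>
    rw [Multiset.card_cons] at hn ⊢
    have h1 := ih (by omega)
    obtain ⟨h, hh, hP⟩ := exists_vanishing_mult_eq hf P s n (by omega)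
    have hlt : vanishing hf n (P ::ₘ s) < vanishing hf n s := by
      refine lt_of_le_of_ne (vanishing_cons_le hf n P s) fun e => ?_
      rw [← e] at hh
      have := hh P
      rw [hP, Multiset.count_cons_self] at this
      have h2 : s.count P + 1 ≤ s.count P := by exact_mod_cast this
      omega
    have := Submodule.finrank_lt_finrank_of_lt hlt
    omega

/-! ### Bézout's theorem for smooth quartics -/

/-- Multiplication by a form, as a linear map. -/
def mulForm {a b n : ℕ} (g : Form a) (hn : n = a + b) : Form b →ₗ[ℂ] Form n :=
  ((LinearMap.mulLeft ℂ g.1).domRestrict (Form b)).codRestrict (Form n) fun h => by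
    subst hn
    exact mul_mem_form g.2 h.2

theorem mulForm_val {a b n : ℕ} (g : Form a) (hn : n = a + b) (h : Form b) :
    (mulForm g hn h).1 = g.1 * h.1 := rfl

/-- The forms `g a + f b` of degree `d + 4 + e`. -/
def combinations (f : Form 4) {d : ℕ} (g : Form d) (e : ℕ) :
    Form (4 + e) × Form (d + e) →ₗ[ℂ] Form (d + 4 + e) :=
  (mulForm g (by ring)).coprod (mulForm f (by ring))

theorem combinations_val (f : Form 4) {d : ℕ} (g : Form d) (e : ℕ)
    (x : Form (4 + e) × Form (d + e)) :
    (combinations f g e x).1 = g.1 * x.1.1 + f.1 * x.2.1 := rfl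

/-- As `f` is prime and does not divide `g`, the only syzygies are the multiples of `(f, -g)`. -/
theorem finrank_ker_combinations_le (hf : Prime f.1) {d : ℕ} (g : Form d) (hg : ¬ f.1 ∣ g.1)
    (e : ℕ) : Module.finrank ℂ (LinearMap.ker (combinations f g e)) ≤
      Module.finrank ℂ (Form e) := by
  have hle : LinearMap.ker (combinations f g e) ≤
      LinearMap.range ((mulForm f (b := e) rfl).prod (-mulForm g (b := e) rfl)) := by
    rintro ⟨a, b⟩ h
    have h1 : g.1 * a.1 + f.1 * b.1 = 0 := congrArg Subtype.val (LinearMap.mem_ker.mp h)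
    have h2 : f.1 ∣ a.1 :=
      (hf.dvd_or_dvd ⟨-b.1, by linear_combination h1⟩).resolve_left hg
    obtain ⟨k, hk⟩ := exists_form_of_dvd f a.2 h2
    refine ⟨k, Prod.ext (Subtype.ext hk.symm) (Subtype.ext ?_)⟩
    change -(g.1 * k.1) = b.1
    refine mul_left_cancel₀ hf.ne_zero ?_
    rw [hk] at h1
    linear_combination -h1
  exact (Submodule.finrank_mono hle).trans (LinearMap.finrank_range_le _)

theorem two_mul_finrank_form (n : ℕ) : 2 * Module.finrank ℂ (Form n) = (n + 2) * (n + 1) := by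
  rw [finrank_form, Nat.choose_two_right]
  exact Nat.mul_div_cancel' (Nat.even_mul_pred_self (n + 2)).two_dvd

theorem finrank_form_le_combinations (hf : Prime f.1) {d : ℕ} (g : Form d) (hg : ¬ f.1 ∣ g.1)
    (e : ℕ) : Module.finrank ℂ (Form (d + 4 + e)) ≤
      Module.finrank ℂ (LinearMap.range (combinations f g e)) + 4 * d := by
  have h1 := finrank_ker_combinations_le hf g hg e
  have h2 := LinearMap.finrank_range_add_finrank_ker (combinations f g e)
  rw [Module.finrank_prod] at h2
  have e1 := two_mul_finrank_form (d + 4 + e)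
  have e2 := two_mul_finrank_form (4 + e)
  have e3 := two_mul_finrank_form (d + e)
  have e4 := two_mul_finrank_form e
  nlinarith

/-- Every `g a + f b` vanishes on `s`. These forms have codimension at most `4 * d`, and in degree
`d + 4 + s.card` vanishing on `s` has codimension at least `s.card`. -/
theorem card_le_of_le_mult (hf : IsSmooth f) {d : ℕ} (g : Form d) (hg : ¬ f.1 ∣ g.1)
    (s : Multiset (Point f)) (hs : g ∈ vanishing hf d s) : s.card ≤ 4 * d := by
  have h1 := finrank_form_le_combinations hf.prime g hg s.card
  have h2 := finrank_vanishing_add_card hf (d + 4 + s.card) s (by omega)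
  have hle : LinearMap.range (combinations f g s.card) ≤
      vanishing hf (d + 4 + s.card) s := by
    rintro _ ⟨⟨a, b⟩, rfl⟩ P
    rw [mult_eq_of_dvd_sub P (h := mulForm g (by ring) a) ⟨b.1, by
      rw [combinations_val, mulForm_val]; ring⟩,
      mult_mul hf P g a _ (by ring) (mulForm_val ..)]
    exact (hs P).trans le_self_add
  have h3 := Submodule.finrank_mono hle
  omega

/-- A multiset of largest size below the divisor of `g` exists by the previous bound; were it
smaller than `mult` at some point, that point could be added. -/
theorem exists_divisor_le (hf : IsSmooth f) {d : ℕ} (g : Form d) (hg : ¬ f.1 ∣ g.1) :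
    ∃ s : Multiset (Point f), (∀ P, mult f g P = s.count P) ∧ s.card ≤ 4 * d := by
  obtain ⟨s, hs, hmax⟩ := WellFounded.has_min
    (measure fun s : Multiset (Point f) => 4 * d - s.card).wf
    {s | g ∈ vanishing hf d s} ⟨0, fun P => by simp⟩
  refine ⟨s, fun P => ?_, card_le_of_le_mult hf g hg s hs⟩
  by_contra hne
  have hlt := lt_of_le_of_ne (hs P) (Ne.symm hne)
  have h1 : g ∈ vanishing hf d (P ::ₘ s) := mem_vanishing_cons hf hs (by
    rw [Nat.cast_add, Nat.cast_one]
    exact Order.add_one_le_of_lt hlt)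
  have h2 := card_le_of_le_mult hf g hg _ h1
  refine hmax _ h1 ?_
  change 4 * d - (P ::ₘ s).card < 4 * d - s.card
  rw [Multiset.card_cons] at h2 ⊢
  omega

theorem exists_form_eq_prod (hf : IsSmooth f) (t : Multiset (Form 1)) :
    ∃ K : Form t.card, K.1 = (t.map Subtype.val).prod ∧
      ∀ P, mult f K P = (t.map fun L => mult f L P).sum := by
  induction t using Multiset.induction_on with
  | empty =>
    refine ⟨Form.const 1, by simp [Form.const], fun P => ?_⟩
    rw [Multiset.map_zero, Multiset.sum_zero]
    exact mult_const P one_ne_zero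
  | cons L t ih =>
    obtain ⟨K, hK, h⟩ := ih
    have hn : (L ::ₘ t).card = 1 + t.card := by rw [Multiset.card_cons, add_comm]
    refine ⟨mulForm L hn K, ?_, fun P => ?_⟩
    · rw [mulForm_val, hK, Multiset.map_cons, Multiset.prod_cons]
    · rw [mult_mul hf P L K _ hn (mulForm_val ..), h, Multiset.map_cons, Multiset.sum_cons]

theorem card_filter_le_sum_mult (hf : IsSmooth f) (P : Point f) (t : Multiset (Form 1)) :
    ((t.filter fun M => eval P.1.rep M.1 = 0).card : ℕ∞) ≤ (t.map fun L => mult f L P).sum := by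
  induction t using Multiset.induction_on with
  | empty => simp
  | cons L t ih =>
    rw [Multiset.map_cons, Multiset.sum_cons]
    by_cases h : eval P.1.rep L.1 = 0
    · rw [Multiset.filter_cons_of_pos (p := fun M : Form 1 => eval P.1.rep M.1 = 0) t h,
        Multiset.card_cons, Nat.cast_add, add_comm]
      exact add_le_add ((one_le_mult_iff hf P).mpr h) ih
    · rw [Multiset.filter_cons_of_neg (p := fun M : Form 1 => eval P.1.rep M.1 = 0) t h]
      exact ih.trans le_add_self

theorem eval_mk_rep_eq_zero_iff {d : ℕ} (g : Form d) {v : Fin 3 → ℂ} (hv : v ≠ 0) :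
    eval (Projectivization.mk ℂ v hv).rep g.1 = 0 ↔ eval v g.1 = 0 := by
  obtain ⟨a, ha⟩ := Projectivization.exists_smul_eq_mk_rep ℂ v hv
  have h : (Projectivization.mk ℂ v hv).rep = fun i => v i * (a : ℂ) := by
    rw [← ha]
    funext i
    rw [mul_comm]
    rfl
  rw [h, eval_mul_const g.2]
  simp

theorem exists_common_zero_lines (L M : Form 1) :
    ∃ P : Plane, eval P.rep L.1 = 0 ∧ eval P.rep M.1 = 0 := by
  have h0 (L : Form 1) : eval 0 L.1 = 0 := by
    have : (0 : Fin 3 → ℂ) = fun i => (0 : Fin 3 → ℂ) i * 0 := by funext; simp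
    rw [this, eval_mul_const L.2]
    simp
  obtain ⟨v, hv, h1, h2⟩ := exists_common_zero (h0 L) (h0 M)
  exact ⟨Projectivization.mk ℂ v hv, (eval_mk_rep_eq_zero_iff L hv).mpr h1,
    (eval_mk_rep_eq_zero_iff M hv).mpr h2⟩

/-- Modulo `L`, the quartic is a constant times a product of four linear forms, and each of them
meets `L` in a point of C. These four points, counted with repetition, lie below the divisor of `L`.
-/
theorem four_le_card_of_line (hf : IsSmooth f) (L : Form 1) (hL : L ≠ 0)
    (s : Multiset (Point f)) (hs : ∀ P, mult f L P = s.count P) : 4 ≤ s.card := by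
  obtain ⟨h, c, t, ht, e⟩ := exists_prod_linear_mod L hL (d := 3) f
  have hzero (M : Form 1) (hM : M ∈ t) (P : Plane) (h1 : eval P.rep L.1 = 0)
      (h2 : eval P.rep M.1 = 0) : eval P.rep f.1 = 0 := by
    obtain ⟨t', rfl⟩ := Multiset.exists_cons_of_mem hM
    rw [e, Multiset.map_cons, Multiset.prod_cons]
    simp [h1, h2]
  -- Outside `t` any point of C will do; it only makes `q` a total function.
  have hpt (M : Form 1) : ∃ P : Point f, M ∈ t →
      eval P.1.rep L.1 = 0 ∧ eval P.1.rep M.1 = 0 := by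
    by_cases hM : M ∈ t
    · obtain ⟨P, h1, h2⟩ := exists_common_zero_lines L M
      exact ⟨⟨P, hzero M hM P h1 h2⟩, fun _ => ⟨h1, h2⟩⟩
    · obtain ⟨M', hM'⟩ := Multiset.card_pos_iff_exists_mem.mp (show 0 < t.card by omega)
      obtain ⟨P, h1, h2⟩ := exists_common_zero_lines L M'
      exact ⟨⟨P, hzero M' hM' P h1 h2⟩, fun h => absurd h hM⟩
  choose q hq using hpt
  suffices hle : t.map q ≤ s by
    have := Multiset.card_le_card hle
    rw [Multiset.card_map] at this
    omega
  refine Multiset.le_iff_count.mpr fun P => ?_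
  suffices hc : ((t.map q).count P : ℕ∞) ≤ mult f L P by
    rw [hs] at hc
    exact_mod_cast hc
  have hcount : (t.map q).count P ≤ (t.filter fun M => eval P.1.rep M.1 = 0).card := by
    rw [Multiset.count_map]
    refine Multiset.card_le_card (Multiset.le_filter.mpr ⟨Multiset.filter_le _ _, ?_⟩)
    intro M hM
    rw [Multiset.mem_filter] at hM
    rw [hM.2]
    exact (hq M hM.1).2
  rcases Nat.lt_or_ge ((t.map q).count P) 2 with h2 | h2
  · by_cases hP : P ∈ t.map q
    · obtain ⟨M, hM, rfl⟩ := Multiset.mem_map.mp hP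
      refine le_trans ?_ ((one_le_mult_iff hf _).mpr (hq M hM).1)
      exact_mod_cast Nat.le_of_lt_succ h2
    · rw [Multiset.count_eq_zero_of_notMem hP]
      simp
  · have hP : P ∈ t.map q := Multiset.count_pos.mp (by omega)
    have hLP : eval P.1.rep L.1 = 0 := by
      obtain ⟨M, hM, rfl⟩ := Multiset.mem_map.mp hP
      exact (hq M hM).1
    -- At least two of the linear forms vanish at `P`, so their product has zero derivatives there.
    -- If `h` vanished too, so would those of `L h`, and `f` would be singular at `P`.
    have hhP : eval P.1.rep h.1 ≠ 0 := by
      intro hh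
      obtain ⟨i, hi⟩ := hf P.1.rep P.1.rep_nonzero P.2
      apply hi
      obtain ⟨M, hM⟩ := Multiset.card_pos_iff_exists_mem.mp
        (show 0 < (t.filter fun M => eval P.1.rep M.1 = 0).card by omega)
      obtain ⟨hMt, hM0⟩ := Multiset.mem_filter.mp hM
      obtain ⟨t', rfl⟩ := Multiset.exists_cons_of_mem hMt
      rw [Multiset.filter_cons_of_pos (p := fun M : Form 1 => eval P.1.rep M.1 = 0) t' hM0,
        Multiset.card_cons] at hcount
      obtain ⟨M', hM'⟩ := Multiset.card_pos_iff_exists_mem.mp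
        (show 0 < (t'.filter fun M => eval P.1.rep M.1 = 0).card by omega)
      obtain ⟨hMt', hM0'⟩ := Multiset.mem_filter.mp hM'
      obtain ⟨t'', rfl⟩ := Multiset.exists_cons_of_mem hMt'
      refine (congrArg (fun F => eval P.1.rep (pderiv i F)) e).trans ?_
      simp [Derivation.leibniz, hLP, hh, hM0, hM0']
    obtain ⟨K, hK, hKm⟩ := exists_form_eq_prod hf t
    have hK4 (n : ℕ) (hn : t.card = n) : K.1 ∈ Form n := by
      subst hn
      exact K.2
    let K' : Form 4 := ⟨K.1, hK4 4 ht⟩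
    have hK' : mult f K' P = mult f K P := by
      have := mult_mul hf P (Form.const 1) K K' (by omega) (by simp [K', Form.const])
      rwa [mult_const P one_ne_zero, zero_add] at this
    -- On C, `L h` equals `-c` times the product of the linear forms, and `h` is a unit at `P`. So
    -- `L` vanishes at least as often as the product.
    have h5 := mult_mul hf P L h (Form.mul L h) rfl rfl
    rw [mult_eq_zero_of_eval_ne_zero P hhP, add_zero,
      mult_eq_of_dvd_sub P (h := (-c) • K') ⟨1, by
        rw [e]
        simp [Form.mul, K', hK, smul_eq_C_mul]⟩] at h5
    rw [← h5]
    refine le_trans ?_ (mult_le_mult_smul P (-c) K')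
    rw [hK', hKm]
    refine le_trans ?_ (card_filter_le_sum_mult hf P t)
    exact_mod_cast hcount

theorem exists_divisor_prod (hf : IsSmooth f) (t : Multiset (Form 1)) (ht : 0 ∉ t) :
    ∃ s : Multiset (Point f), 4 * t.card ≤ s.card ∧
      ∀ P, (t.map fun L => mult f L P).sum = s.count P := by
  induction t using Multiset.induction_on with
  | empty => exact ⟨0, by simp, by simp⟩
  | cons L t ih =>
    rw [Multiset.mem_cons, not_or] at ht
    obtain ⟨s, hs, h⟩ := ih ht.2
    obtain ⟨s', h', -⟩ := exists_divisor_le hf L fun hd =>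
      ht.1 (Subtype.ext (eq_zero_of_dvd_form (by norm_num) L.2 hd)).symm
    have h4 := four_le_card_of_line hf L (Ne.symm ht.1) s' h'
    refine ⟨s' + s, ?_, fun P => ?_⟩
    · rw [Multiset.card_cons, Multiset.card_add]
      omega
    · rw [Multiset.map_cons, Multiset.sum_cons, h, h', Multiset.count_add, Nat.cast_add]

theorem binary_mem_form (n : ℕ) (p : Polynomial ℂ) :
    binary (X 0) (X 1) n p ∈ Form n := by
  refine Submodule.sum_mem _ fun i hi => ?_
  rw [Finset.mem_range] at hi
  have h1 := mul_mem_form (isHomogeneous_X_pow (R := ℂ) (0 : Fin 3) i)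
    (isHomogeneous_X_pow (R := ℂ) (1 : Fin 3) (n - i))
  rw [show i + (n - i) = n by omega] at h1
  exact IsHomogeneous.C_mul h1 _

theorem binary_ne_zero (n : ℕ) {p : Polynomial ℂ} (hp : p ≠ 0) (hn : p.natDegree < n + 1) :
    binary (X 0) (X 1) n p ≠ 0 := by
  intro h
  apply hp
  refine Polynomial.funext fun x => ?_
  have := congrArg (eval ![x, 1, 0]) h
  simpa [binary, Polynomial.eval_eq_sum_range' hn] using this

/-- Binary forms of degree `n`, as a linear image of the polynomials of degree at most `n`. -/
def binaryMap (n : ℕ) : Polynomial.degreeLT ℂ (n + 1) →ₗ[ℂ] Form n where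
  toFun p := ⟨binary (X 0) (X 1) n p.1, binary_mem_form n p.1⟩
  map_add' p q := Subtype.ext (binary_add ..)
  map_smul' c p := Subtype.ext (by
    simp only [Submodule.coe_smul, RingHom.id_apply, smul_eq_C_mul, Polynomial.smul_eq_C_mul]
    exact binary_C_mul ..)

/-- Binary forms of degree `n` have dimension `n + 1 > 4 * d`, more than the codimension of the
forms `g a + f b`. Some nonzero binary form is therefore of this shape, and it splits into lines. -/
theorem exists_prod_lines_mem_combinations (hf : Prime f.1) {d : ℕ} (g : Form d)
    (hg : ¬ f.1 ∣ g.1) :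
    ∃ (c : ℂ) (t : Multiset (Form 1)) (a : Form (4 + 4 * d)) (b : Form (d + 4 * d)),
      c ≠ 0 ∧ 0 ∉ t ∧ t.card = d + 4 + 4 * d ∧
      C c * (t.map Subtype.val).prod = g.1 * a.1 + f.1 * b.1 := by
  set n := d + 4 + 4 * d
  set R := LinearMap.range (combinations f g (4 * d))
  have h1 := finrank_form_le_combinations hf g hg (4 * d)
  have h2 := R.finrank_quotient_add_finrank
  have h3 : Module.finrank ℂ (Polynomial.degreeLT ℂ (n + 1)) = n + 1 := by
    rw [(Polynomial.degreeLTEquiv ℂ (n + 1)).finrank_eq]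
    simp
  have : Module.Finite ℂ (Polynomial.degreeLT ℂ (n + 1)) :=
    Module.Finite.equiv (Polynomial.degreeLTEquiv ℂ (n + 1)).symm
  have h4 := LinearMap.ker_ne_bot_of_finrank_lt (f := R.mkQ.comp (binaryMap n)) (by
    rw [h3]
    change _ ≤ Module.finrank ℂ R + _ at h1
    change _ = Module.finrank ℂ (Form n) at h2
    change Module.finrank ℂ (Form n) ≤ _ at h1
    omega)
  obtain ⟨p, hp, hp0⟩ := Submodule.exists_mem_ne_zero_of_ne_bot h4
  rw [LinearMap.mem_ker, LinearMap.comp_apply, Submodule.mkQ_apply,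
    Submodule.Quotient.mk_eq_zero] at hp
  obtain ⟨⟨a, b⟩, hab⟩ := hp
  have hp0' : p.1 ≠ 0 := fun h => hp0 (Subtype.ext h)
  have hdeg : p.1.natDegree < n + 1 :=
    (Polynomial.natDegree_lt_iff_degree_lt hp0').mpr (Polynomial.mem_degreeLT.mp p.2)
  obtain ⟨c, t, ht, e⟩ := exists_binary_eq_prod ⟨X 0, isHomogeneous_X ℂ 0⟩
    ⟨X 1, isHomogeneous_X ℂ 1⟩ n p.1 (Nat.le_of_lt_succ hdeg)
  have hne := binary_ne_zero n hp0' hdeg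
  rw [e] at hne
  refine ⟨c, t, a, b, fun h => hne (by rw [h, C_0, zero_mul]), fun h => hne ?_, ht, ?_⟩
  · rw [Multiset.prod_eq_zero (Multiset.mem_map.mpr ⟨0, h, rfl⟩), mul_zero]
  · rw [← e, ← combinations_val f g (4 * d) (a, b), hab]
    rfl

/-- **Bézout's theorem** for a smooth plane quartic. -/
theorem exists_divisor (hf : IsSmooth f) {d : ℕ} (g : Form d) (hg : ¬ f.1 ∣ g.1) :
    ∃ s : Multiset (Point f), (∀ P, mult f g P = s.count P) ∧ s.card = 4 * d := by
  obtain ⟨s, hs, hle⟩ := exists_divisor_le hf g hg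
  refine ⟨s, hs, le_antisymm hle ?_⟩
  obtain ⟨c, t, a, b, hc, ht, htc, e⟩ := exists_prod_lines_mem_combinations hf.prime g hg
  obtain ⟨K, hK, hKm⟩ := exists_form_eq_prod hf t
  obtain ⟨u, hu, hum⟩ := exists_divisor_prod hf t ht
  have hK' : (c • K).1 = g.1 * a.1 + f.1 * b.1 := by
    rw [← e, ← hK]
    exact smul_eq_C_mul _ _
  have hn : t.card = d + (4 + 4 * d) := by omega
  have hmult (P : Point f) : mult f K P = mult f g P + mult f a P := by
    have h1 := mult_mul hf P (Form.const c) K (c • K) (zero_add _).symm (smul_eq_C_mul _ _)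
    rw [mult_const P hc, zero_add] at h1
    rw [← h1, mult_eq_of_dvd_sub P (h := mulForm g hn a) ⟨b.1, by
      rw [hK', mulForm_val]; ring⟩, mult_mul hf P g a _ hn (mulForm_val ..)]
  have ha : ¬ f.1 ∣ a.1 := by
    intro ha
    have h1 : f.1 ∣ C c * (t.map Subtype.val).prod := by
      rw [e]
      exact dvd_add (ha.mul_left _) (dvd_mul_right _ _)
    rcases hf.prime.dvd_or_dvd h1 with h2 | h2
    · exact hc (C_eq_zero.mp (eq_zero_of_dvd_form (by norm_num) (isHomogeneous_C _ c) h2))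
    · obtain ⟨L', hL', h3⟩ := hf.prime.exists_mem_multiset_dvd h2
      obtain ⟨L, hL, rfl⟩ := Multiset.mem_map.mp hL'
      have : L = 0 := Subtype.ext (eq_zero_of_dvd_form (by norm_num) L.2 h3)
      exact ht (this ▸ hL)
  obtain ⟨s', hs', hle'⟩ := exists_divisor_le hf a ha
  have hsum : u = s + s' := by
    ext P
    have h1 := hmult P
    rw [hKm, hum, hs, hs'] at h1
    rw [Multiset.count_add]
    exact_mod_cast h1
  -- The product has degree at least `4 * (d + 4 + 4 * d)` on C and `a` at most `4 * (4 + 4 * d)`,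
  -- which leaves at least `4 * d` for `g`.
  rw [hsum, Multiset.card_add] at hu
  omega

theorem not_dvd_of_ne_zero {d : ℕ} (hd : d < 4) {g : Form d} (hg : g ≠ 0) : ¬ f.1 ∣ g.1 :=
  fun h => hg (Subtype.ext (eq_zero_of_dvd_form hd g.2 h))

/-- Through fewer points than the dimension of the space of curves of degree `d` there is such
a curve. -/
theorem exists_form_through (hf : IsSmooth f) {d : ℕ} (hd : d < 4) (s : Multiset (Point f))
    (hs : s.card < (d + 2).choose 2) :
    ∃ (g : Form d) (t : Multiset (Point f)), g ≠ 0 ∧ s.card + t.card = 4 * d ∧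
      ∀ P, mult f g P = (s + t).count P := by
  have h1 := finrank_form_le_vanishing hf d s
  rw [finrank_form] at h1
  have h2 : vanishing hf d s ≠ ⊥ := by
    intro h
    rw [h, finrank_bot] at h1
    omega
  obtain ⟨g, hg, hg0⟩ := Submodule.exists_mem_ne_zero_of_ne_bot h2
  obtain ⟨u, hu, huc⟩ := exists_divisor hf g (not_dvd_of_ne_zero hd hg0)
  have hle : s ≤ u := Multiset.le_iff_count.mpr fun P => by
    have := hg P
    rw [hu] at this
    exact_mod_cast this
  obtain ⟨t, rfl⟩ := Multiset.le_iff_exists_add.mp hle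
  exact ⟨g, t, hg0, by rw [← huc, Multiset.card_add], hu⟩

end Vanishing

/-! ### Effective divisors as multisets -/

section Effective

variable {f : Form 4}

/-- The effective divisor given by a multiset of points. -/
def ofMultiset (s : Multiset (Point f)) : Divisor f := (s.map pt).sum

theorem ofMultiset_add (s t : Multiset (Point f)) :
    ofMultiset (s + t) = ofMultiset s + ofMultiset t := by
  simp [ofMultiset]

theorem ofMultiset_apply (s : Multiset (Point f)) (P : Point f) : ofMultiset s P = s.count P := by
  induction s using Multiset.induction_on with
  | empty => simp [ofMultiset]
  | cons Q s ih =>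
    rw [ofMultiset] at ih ⊢
    rw [Multiset.map_cons, Multiset.sum_cons, Finsupp.add_apply, ih, Multiset.count_cons,
      Finsupp.single_apply]
    by_cases h : Q = P
    · simp [h, add_comm]
    · simp [h, Ne.symm h]

theorem degree_ofMultiset (s : Multiset (Point f)) : degree (ofMultiset s) = s.card := by
  induction s using Multiset.induction_on with
  | empty => simp [ofMultiset]
  | cons Q s ih =>
    rw [ofMultiset] at ih ⊢
    rw [Multiset.map_cons, Multiset.sum_cons, map_add, ih]
    simp [add_comm]

theorem ofMultiset_nonneg (s : Multiset (Point f)) : 0 ≤ ofMultiset s := fun P => by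
  rw [ofMultiset_apply]
  exact Int.natCast_nonneg _

theorem exists_eq_ofMultiset {D : Divisor f} (hD : 0 ≤ D) : ∃ s, D = ofMultiset s := by
  refine ⟨Finsupp.toMultiset (D.mapRange Int.toNat rfl), ?_⟩
  ext P
  rw [ofMultiset_apply, Finsupp.count_toMultiset, Finsupp.mapRange_apply,
    Int.toNat_of_nonneg (hD P)]

/-- The multiset of the points of a triple. -/
def tripleMultiset (T : Fin 3 → Point f) : Multiset (Point f) := {T 0, T 1, T 2}

theorem tripleSum_eq (T : Fin 3 → Point f) : tripleSum T = ofMultiset (tripleMultiset T) := by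
  simp [tripleSum, tripleMultiset, ofMultiset, Fin.sum_univ_three, add_assoc]

theorem card_tripleMultiset (T : Fin 3 → Point f) : (tripleMultiset T).card = 3 := rfl

theorem pt_eq (P : Point f) : pt P = ofMultiset {P} := by
  simp [ofMultiset]

/-- Used with `d = 1, 3, 2` and 2, 9, 5 points, each time one fewer than the dimension 3, 10, 6. -/
theorem exists_intersectsIn (hf : IsSmooth f) {d : ℕ} (hd : d < 4) (s : Multiset (Point f))
    (hs : s.card < (d + 2).choose 2) :
    ∃ (g : Form d) (D : Divisor f), g ≠ 0 ∧ 0 ≤ D ∧ degree D = 4 * d - s.card ∧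
      IntersectsIn g (ofMultiset s + D) := by
  obtain ⟨g, t, hg, hc, h⟩ := exists_form_through hf hd s hs
  refine ⟨g, ofMultiset t, hg, ofMultiset_nonneg t, ?_, fun P => ⟨_, h P, ?_⟩⟩
  · rw [degree_ofMultiset]
    omega
  · rw [← ofMultiset_add, ofMultiset_apply]

theorem exists_stepLine (hf : IsSmooth f) (P : Fin 3 → Point f) :
    ∃ (l : Form 1) (A : Divisor f), StepLine P l A := by
  obtain ⟨l, A, h0, h1, h2, h3⟩ :=
    exists_intersectsIn hf (d := 1) (by norm_num) ({P 0} + {P 1}) (by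
      rw [Multiset.card_add, Multiset.card_singleton, Multiset.card_singleton]; decide)
  rw [ofMultiset_add, ← pt_eq, ← pt_eq] at h3
  exact ⟨l, A, h0, h1, by rw [h2]; simp, h3⟩

theorem exists_stepCubic (hf : IsSmooth f) {P : Fin 3 → Point f} (Q R : Fin 3 → Point f)
    (B : Point f) {l : Form 1} {A : Divisor f} (hl : StepLine P l A) :
    ∃ (c : Form 3) (E : Divisor f), StepCubic Q R A B c E := by
  obtain ⟨-, hA, hA2, -⟩ := hl
  obtain ⟨a, rfl⟩ := exists_eq_ofMultiset hA
  rw [degree_ofMultiset] at hA2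
  have hcard : (tripleMultiset Q + tripleMultiset R + a + {B}).card = 9 := by
    simp only [Multiset.card_add, card_tripleMultiset, Multiset.card_singleton]
    omega
  obtain ⟨c, E, h0, h1, h2, h3⟩ := exists_intersectsIn hf (d := 3) (by norm_num)
    (tripleMultiset Q + tripleMultiset R + a + {B}) (by rw [hcard]; decide)
  rw [ofMultiset_add, ofMultiset_add, ofMultiset_add, ← pt_eq, ← tripleSum_eq,
    ← tripleSum_eq] at h3
  exact ⟨c, E, h0, h1, by rw [h2, hcard]; norm_num, h3⟩

theorem exists_stepConic (hf : IsSmooth f) (P : Fin 3 → Point f) {Q R : Fin 3 → Point f}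
    {B : Point f} {A : Divisor f} {c : Form 3} {E : Divisor f} (hc : StepCubic Q R A B c E) :
    ∃ (n : Form 2) (S : Divisor f), StepConic P B E n S := by
  obtain ⟨-, hE, hE3, -⟩ := hc
  obtain ⟨e, rfl⟩ := exists_eq_ofMultiset hE
  rw [degree_ofMultiset] at hE3
  have hcard : (({B} : Multiset (Point f)) + {P 2} + e).card = 5 := by
    simp only [Multiset.card_add, Multiset.card_singleton]
    omega
  obtain ⟨n, S, h0, h1, h2, h3⟩ := exists_intersectsIn hf (d := 2) (by norm_num)
    ({B} + {P 2} + e) (by rw [hcard]; decide)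
  rw [ofMultiset_add, ofMultiset_add, ← pt_eq, ← pt_eq] at h3
  exact ⟨n, S, h0, h1, by rw [h2, hcard]; norm_num, h3⟩

theorem exists_stepOutput {P : Fin 3 → Point f} {B : Point f} {E : Divisor f} {n : Form 2}
    {D : Divisor f} (hn : StepConic P B E n D) : ∃ S : Fin 3 → Point f, StepOutput D S := by
  obtain ⟨-, hD, hD3, -⟩ := hn
  obtain ⟨s, rfl⟩ := exists_eq_ofMultiset hD
  rw [degree_ofMultiset] at hD3
  obtain ⟨x, y, z, rfl⟩ := Multiset.card_eq_three.mp (by exact_mod_cast hD3)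
  exact ⟨![x, y, z], tripleSum_eq _⟩

/-! ### Rational functions -/

theorem exists_isQuotient (hf : Prime f.1) (g : MvPolynomial (Fin 3) ℂ)
    {h : MvPolynomial (Fin 3) ℂ} (hh : ¬ f.1 ∣ h) : ∃ φ : Fractions f, IsQuotient φ g h := by
  have hh' : h ∉ Ideal.span {f.1} := fun hm => hh (Ideal.mem_span_singleton.mp hm)
  have hprime : (Ideal.span {f.1}).IsPrime := (Ideal.span_singleton_prime hf.ne_zero).mpr hf
  have : IsDomain (CoordRing f) := (Ideal.Quotient.isDomain_iff_prime _).mpr hprime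
  have hne : toFractions f h ≠ 0 := by
    rw [toFractions, Ne, FaithfulSMul.algebraMap_eq_zero_iff, Ideal.Quotient.eq_zero_iff_mem]
    exact hh'
  exact ⟨toFractions f g / toFractions f h, hh', div_mul_cancel₀ _ hne⟩

theorem LinearlyEquivalent.sub_mem {D D' : Divisor f} (h : LinearlyEquivalent D D') :
    D - D' ∈ principalDivisors f := by
  obtain ⟨φ, hφ⟩ := h
  exact AddSubgroup.subset_closure ⟨φ, hφ⟩

theorem represents_add {P Q R S : Fin 3 → Point f}
    (h : LinearlyEquivalent (tripleSum S - tripleSum P)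
      ((tripleSum Q - tripleSum P) + (tripleSum R - tripleSum P)))
    {x y : Jacobian f} (hx : Represents P Q x) (hy : Represents P R y) :
    Represents P S (x + y) := by
  rw [Represents] at hx hy ⊢
  subst hx hy
  rw [← QuotientAddGroup.mk_add]
  refine (QuotientAddGroup.eq.mpr ?_).symm
  rw [AddSubgroup.mem_addSubgroupOf]
  have := h.sub_mem
  rw [sub_eq_neg_add] at this
  exact this

/-- The function `c / (l n)` obtained from a run of the algorithm. -/
theorem output_correct (hf : IsSmooth f) {P Q R S : Fin 3 → Point f} {B : Point f} {l : Form 1}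
    {A : Divisor f} {c : Form 3} {E : Divisor f} {n : Form 2} {D : Divisor f}
    (hl : StepLine P l A) (hc : StepCubic Q R A B c E) (hn : StepConic P B E n D)
    (hS : StepOutput D S) :
    (∃ φ : Fractions f, IsQuotient φ c.1 (l.1 * n.1) ∧
      HasDivisor φ (tripleSum Q + tripleSum R - tripleSum P - tripleSum S)) ∧
    LinearlyEquivalent (tripleSum S - tripleSum P)
      ((tripleSum Q - tripleSum P) + (tripleSum R - tripleSum P)) := by
  obtain ⟨hl0, -, -, hl⟩ := hl
  obtain ⟨hc0, -, -, hc⟩ := hc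
  obtain ⟨hn0, -, -, hn⟩ := hn
  rw [StepOutput] at hS
  subst hS
  have hfp := hf.prime
  have hcd := not_dvd_of_ne_zero (f := f) (by norm_num) hc0
  have hlnd : ¬ f.1 ∣ l.1 * n.1 := fun h =>
    (hfp.dvd_or_dvd h).elim (not_dvd_of_ne_zero (by norm_num) hl0)
      (not_dvd_of_ne_zero (by norm_num) hn0)
  -- The auxiliary `A`, `B` and `E` cancel here, pointwise.
  have key (X : Point f) : ∃ a b : ℕ, mult f c X = a ∧ mult f (Form.mul l n : Form 3) X = b ∧
      (tripleSum Q + tripleSum R - tripleSum P - tripleSum S) X = (a : ℤ) - b := by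
    obtain ⟨a, ha, ha'⟩ := hc X
    obtain ⟨b₁, hb₁, hb₁'⟩ := hl X
    obtain ⟨b₂, hb₂, hb₂'⟩ := hn X
    refine ⟨a, b₁ + b₂, ha, ?_, ?_⟩
    · rw [mult_mul hf X l n (Form.mul l n : Form 3) rfl rfl, hb₁, hb₂, Nat.cast_add]
    · have hP : tripleSum P = pt (P 0) + pt (P 1) + pt (P 2) := by
        rw [tripleSum, Fin.sum_univ_three]
      rw [Nat.cast_add, ← ha', ← hb₁', ← hb₂', hP]
      simp only [Finsupp.add_apply, Finsupp.sub_apply]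
      ring
  refine ⟨?_, ?_⟩
  · obtain ⟨φ, hφ⟩ := exists_isQuotient hfp c.1 hlnd
    refine ⟨φ, hφ, fun X => ?_⟩
    obtain ⟨a, b, ha, hb, hab⟩ := key X
    exact ⟨3, c, Form.mul l n, a, b, hφ, ha, hb, hab⟩
  -- The difference required here is minus the divisor of `c / (l n)`, so the witness is the inverse
  -- function `l n / c`.
  · obtain ⟨φ, hφ⟩ := exists_isQuotient hfp (l.1 * n.1) hcd
    refine ⟨φ, fun X => ?_⟩
    obtain ⟨a, b, ha, hb, hab⟩ := key X
    refine ⟨3, Form.mul l n, c, b, a, hφ, hb, ha, ?_⟩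
    simp only [Finsupp.add_apply, Finsupp.sub_apply] at hab ⊢
    linear_combination -hab

end Effective

end PlaneQuartic

end

theorem mainTheorem4 (f : PlaneQuartic.Form 4) (hf : PlaneQuartic.IsSmooth f)
    (P Q R : Fin 3 → PlaneQuartic.Point f) (B : PlaneQuartic.Point f) :
    -- every step can be carried out, whatever was chosen in the steps before it
    (∃ (l : PlaneQuartic.Form 1) (A : PlaneQuartic.Divisor f), PlaneQuartic.StepLine P l A) ∧
    (∀ (l : PlaneQuartic.Form 1) (A : PlaneQuartic.Divisor f), PlaneQuartic.StepLine P l A →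
      ∃ (c : PlaneQuartic.Form 3) (E : PlaneQuartic.Divisor f),
        PlaneQuartic.StepCubic Q R A B c E) ∧
    (∀ (l : PlaneQuartic.Form 1) (A : PlaneQuartic.Divisor f) (c : PlaneQuartic.Form 3)
      (E : PlaneQuartic.Divisor f),
      PlaneQuartic.StepLine P l A → PlaneQuartic.StepCubic Q R A B c E →
      ∃ (n : PlaneQuartic.Form 2) (D : PlaneQuartic.Divisor f),
        PlaneQuartic.StepConic P B E n D) ∧
    (∀ (l : PlaneQuartic.Form 1) (A : PlaneQuartic.Divisor f) (c : PlaneQuartic.Form 3)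
      (E : PlaneQuartic.Divisor f) (n : PlaneQuartic.Form 2) (D : PlaneQuartic.Divisor f),
      PlaneQuartic.StepLine P l A → PlaneQuartic.StepCubic Q R A B c E →
      PlaneQuartic.StepConic P B E n D →
      ∃ S : Fin 3 → PlaneQuartic.Point f, PlaneQuartic.StepOutput D S) ∧
    -- the output of every run is correct
    (∀ (l : PlaneQuartic.Form 1) (A : PlaneQuartic.Divisor f) (c : PlaneQuartic.Form 3)
      (E : PlaneQuartic.Divisor f) (n : PlaneQuartic.Form 2) (D : PlaneQuartic.Divisor f)
      (S : Fin 3 → PlaneQuartic.Point f),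
      PlaneQuartic.StepLine P l A → PlaneQuartic.StepCubic Q R A B c E →
      PlaneQuartic.StepConic P B E n D → PlaneQuartic.StepOutput D S →
      (∃ φ : PlaneQuartic.Fractions f, PlaneQuartic.IsQuotient φ c.1 (l.1 * n.1) ∧
        PlaneQuartic.HasDivisor φ
          (PlaneQuartic.tripleSum Q + PlaneQuartic.tripleSum R
            - PlaneQuartic.tripleSum P - PlaneQuartic.tripleSum S)) ∧
      PlaneQuartic.LinearlyEquivalent
        (PlaneQuartic.tripleSum S - PlaneQuartic.tripleSum P)
        ((PlaneQuartic.tripleSum Q - PlaneQuartic.tripleSum P)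
          + (PlaneQuartic.tripleSum R - PlaneQuartic.tripleSum P)) ∧
      ∀ x y : PlaneQuartic.Jacobian f,
        PlaneQuartic.Represents P Q x → PlaneQuartic.Represents P R y →
          PlaneQuartic.Represents P S (x + y)) := by
  refine ⟨PlaneQuartic.exists_stepLine hf P,
    fun l A hl => PlaneQuartic.exists_stepCubic hf Q R B hl,
    fun l A c E _ hc => PlaneQuartic.exists_stepConic hf P hc,
    fun l A c E n D _ _ hn => PlaneQuartic.exists_stepOutput hn,
    fun l A c E n D S hl hc hn hS => ?_⟩
  obtain ⟨h1, h2⟩ := PlaneQuartic.output_correct hf hl hc hn hS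
  exact ⟨h1, h2, fun x y hx hy => PlaneQuartic.represents_add h2 hx hy⟩
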